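/- Let $N\ge 1$ and let $d_0,d_1,\dots,d_N$ be the widths of a linear network. Put $m=d_0$, $n=d_N$, $\underline d=\min\{d_0,\dots,d_N\}$, let $\Theta=\prod_{j=1}^N\mathbb R^{d_j\times d_{j-1}}$ be the parameter space and $\mu\colon\Theta\to\mathbb R^{n\times m}$, $\mu(W_1,\dots,W_N)=W_N\cdots W_1$. For $k\in\mathbb N$ let $\mathcal M(k)$ be the embedded submanifold of $\mathbb R^{n\times m}$ of matrices of rank exactly $k$. Let $\Sigma_0=\Omega\Lambda\Omega^\top$ with $\Omega\in\mathbb R^{n\times n}$ orthogonal and $\Lambda=\mathrm{diag}(\lambda_1,\dots,\lambda_n)$, $\lambda_1>\dots>\lambda_n>0$, and let $0<\tau\le\lambda_n$. Define the perturbed Bures--Wasserstein losses $$L^1_\tau(W)=\operatorname{tr}\Big(WW^\top+\tau I_n+\Sigma_0-2\big(\Sigma_0^{1/2}(WW^\top+\tau I_n)\Sigma_0^{1/2}\big)^{1/2}\Big)\quad(W\in\mathbb R^{n\times m}),\qquad L^N_\tau=L^1_\tau\circ\mu\quad\text{on }\Theta .$$ A critical point of $L^N_\tau$ is a point at which its differential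 vanishes; a critical point of $L^1_\tau|_{\mathcal M(k)}$ is a point of $\mathcal M(k)$ at which the differential of the restriction vanishes on the tangent space of $\mathcal M(k)$. 1. If $\theta\in\Theta$ is a critical point of $L^N_\tau$ and $k=\operatorname{rank}\mu(\theta)$, then $\mu(\theta)$ is a critical point of $L^1_\tau|_{\mathcal M(k)}$. 2. Let $\theta\in\Theta$ satisfy $\operatorname{rank}\mu(\theta)=\underline d$, and write $W=\mu(\theta)$. Then $\theta$ is a local minimizer of $L^N_\tau$ if and only if $W$ is a local minimizer of $L^1_\tau|_{\mathcal M(\underline d)}$, and this holds if and only if $W$ is a global minimizer of $L^1_\tau|_{\mathcal M(\underline d)}$. In this case $$WW^\top+\tau I_n=\Omega\,\mathrm{diag}(\lambda_1,\dots,\lambda_{\underline d},\tau,\dots,\tau)\,\Omega^\top .$$ -/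

import Mathlib

open scoped ContDiff Topology Matrix

noncomputable section

/-! ### Matrix square root and the Bures-Wasserstein loss -/

/-- The positive semidefinite square root of a real symmetric positive semidefinite matrix
(functional calculus for symmetric matrices). -/
def matSqrt {n : ℕ} (A : Matrix (Fin n) (Fin n) ℝ) : Matrix (Fin n) (Fin n) ℝ :=
  cfc Real.sqrt A

/-- The squared Bures-Wasserstein distance
`B²(S, S₀) = tr (S + S₀ - 2 (S₀^{1/2} S S₀^{1/2})^{1/2})`. -/
def buresWassersteinSq {n : ℕ} (S S₀ : Matrix (Fin n) (Fin n) ℝ) : ℝ :=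
  Matrix.trace (S + S₀ - (2 : ℝ) • matSqrt (matSqrt S₀ * S * matSqrt S₀))

/-- The perturbative loss `L_τ` on covariance matrices: `S ↦ B²(S + τ I, S₀)`. -/
def covLoss {n : ℕ} (S₀ : Matrix (Fin n) (Fin n) ℝ) (τ : ℝ)
    (S : Matrix (Fin n) (Fin n) ℝ) : ℝ :=
  buresWassersteinSq (S + τ • (1 : Matrix (Fin n) (Fin n) ℝ)) S₀

/-- The perturbative loss `L¹_τ` on end-to-end matrices: `W ↦ L_τ (W Wᵀ)`. -/
def funcLoss {n m : ℕ} (S₀ : Matrix (Fin n) (Fin n) ℝ) (τ : ℝ)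
    (W : Matrix (Fin n) (Fin m) ℝ) : ℝ :=
  covLoss S₀ τ (W * Wᵀ)

/-! ### Deep linear networks -/

/-- Parameters of a linear network with `N` layers and widths `d 0, …, d N`. The index `j` is
zero-based: `θ j` is the weight matrix `W_{j+1}`, of size `d (j+1) × d j`. -/
abbrev Params (d : ℕ → ℕ) (N : ℕ) : Type :=
  (j : Fin N) → Matrix (Fin (d (j + 1))) (Fin (d j)) ℝ

/-- The weight matrix of the last layer. -/
def lastLayer {d : ℕ → ℕ} {N : ℕ} (θ : Params d (N + 1)) :
    Matrix (Fin (d (N + 1))) (Fin (d N)) ℝ :=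
  θ (Fin.last N)

/-- The parametrization map: the end-to-end matrix `W_N ⋯ W_1`. -/
def endToEnd (d : ℕ → ℕ) : (N : ℕ) → Params d N → Matrix (Fin (d N)) (Fin (d 0)) ℝ
  | 0, _ => 1
  | N + 1, θ => lastLayer θ * endToEnd d N (fun j => θ j.castSucc)

/-- The minimal width `min {d 0, …, d N}`. -/
def minWidth (d : ℕ → ℕ) (N : ℕ) : ℕ :=
  (Finset.range (N + 1)).inf' Finset.nonempty_range_add_one d

/-- The perturbative loss `L^N_τ` on the parameter space: `θ ↦ L¹_τ (W_N ⋯ W_1)`. -/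
def paramLoss (d : ℕ → ℕ) (N : ℕ) (S₀ : Matrix (Fin (d N)) (Fin (d N)) ℝ) (τ : ℝ)
    (θ : Params d N) : ℝ :=
  funcLoss S₀ τ (endToEnd d N θ)

/-! ### Critical points -/

/-- The set of real `n × m` matrices of rank exactly `k`. -/
def rankManifold (n m k : ℕ) : Set (Matrix (Fin n) (Fin m) ℝ) :=
  {W | W.rank = k}

/-- A critical point of `f`: `f` is differentiable at `x` with vanishing differential. -/
def IsCriticalPoint {E : Type*} [NormedAddCommGroup E] [NormedSpace ℝ E]
    (f : E → ℝ) (x : E) : Prop :=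
  HasFDerivAt f (0 : E →L[ℝ] ℝ) x

/-- The tangent space at `x` to an embedded submanifold `M` of a normed space: the set of the
velocities at time `0` of the smooth curves through `x` that stay in `M`. -/
def submanifoldTangent {E : Type*} [NormedAddCommGroup E] [NormedSpace ℝ E]
    (M : Set E) (x : E) : Set E :=
  {v | ∃ γ : ℝ → E, ContDiffAt ℝ ∞ γ 0 ∧ (∀ᶠ t in 𝓝 (0 : ℝ), γ t ∈ M) ∧
    γ 0 = x ∧ deriv γ 0 = v}

/-- `x` is a critical point of the restriction of `f` to the embedded submanifold `M`: the
restriction is differentiable and its differential vanishes on the tangent space at `x`.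
(On tangent vectors the value of a derivative within `M` does not depend on its choice.) -/
structure IsCriticalPointOn {E : Type*} [NormedAddCommGroup E] [NormedSpace ℝ E]
    (f : E → ℝ) (M : Set E) (x : E) : Prop where
  mem : x ∈ M
  differentiableOn : DifferentiableOn ℝ f M
  differential_eq_zero : ∀ v ∈ submanifoldTangent M x, fderivWithin ℝ f M x v = 0

end

-- Spaces of matrices carry the Frobenius norm.
attribute [local instance] Matrix.frobeniusNormedAddCommGroup Matrix.frobeniusNormedSpace

/-!
With `S = W Wᵀ + τ I`, the gradient of the loss `L¹` at `W` is `2 (I - T) W`, where `T` is the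
optimal transport map, the positive solution of `T S T = Σ₀`.

Matrices `W` near `μ(θ)` and of no larger rank have the form `P μ(θ) Q`, with `P` and `Q` depending
differentiably on `W`. Absorbing these factors into the outer layers of `θ` yields a local section
of `μ` through `θ`, and composing with it carries critical points and local minimizers of `L^N` over
to the rank stratum. Conversely, lower semicontinuity of the rank keeps `μ(θ')` in the stratum of
maximal rank for `θ'` near `θ`.

At a local minimizer on a rank stratum, left multiplication by `I + t (I - T)` is an admissible
variation, so `T W = W`. Squaring out `T`, the matrix `K = W Wᵀ` satisfies `Σ₀ K = K² + τ K`, hence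
commutes with `Σ₀`. After diagonalizing, `K` is diagonal with entries `0` or `λᵢ - τ`, and a small
plane rotation decreases the loss unless the nonzero entries sit at the largest `λᵢ`. The loss at a
local minimizer therefore depends only on the rank, decreasingly, and comparison with a minimizer
over the closed set of matrices of rank at most `k`, which exists by coercivity, shows that local
minimizers are global.
-/

section TraceInequalities

theorem posSemidef_mul_transpose_self {m n : Type*} [Fintype m] [Finite n] (A : Matrix n m ℝ) :
    (A * Aᵀ).PosSemidef := by
  simpa only [Matrix.conjTranspose_eq_transpose_of_trivial] using
    Matrix.posSemidef_self_mul_conjTranspose A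

variable {m n : Type*} [Fintype m] [Fintype n]

theorem trace_mul_mul_transpose_nonneg {A : Matrix n n ℝ} (hA : A.PosSemidef) (X : Matrix n m ℝ) :
    0 ≤ (A * (X * Xᵀ)).trace := by
  rw [← Matrix.mul_assoc, Matrix.trace_mul_comm, ← Matrix.mul_assoc]
  simpa only [Matrix.conjTranspose_eq_transpose_of_trivial] using
    (hA.conjTranspose_mul_mul_same X).trace_nonneg

theorem frobenius_norm_sq_eq_trace (X : Matrix n m ℝ) : ‖X‖ ^ 2 = (X * Xᵀ).trace := by
  rw [Matrix.frobenius_norm_def, ← Real.sqrt_eq_rpow, Real.sq_sqrt (by positivity)]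
  simp only [Real.norm_eq_abs, Real.rpow_ofNat, sq_abs]
  simp only [sq, Matrix.trace, Matrix.diag_apply, Matrix.mul_apply, Matrix.transpose_apply]

theorem abs_trace_mul_le (X : Matrix n m ℝ) (Y : Matrix m n ℝ) :
    |(X * Y).trace| ≤ ‖X‖ * ‖Y‖ := by
  have expansion (t : ℝ) :
      0 ≤ ‖Y‖ ^ 2 * (t * t) + (2 * (X * Y).trace) * t + ‖X‖ ^ 2 := by
    have := frobenius_norm_sq_eq_trace (X + t • Yᵀ)
    have cross : (Yᵀ * Xᵀ).trace = (X * Y).trace := by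
      rw [← Matrix.transpose_mul, Matrix.trace_transpose]
    simp only [Matrix.transpose_add, Matrix.transpose_transpose, Matrix.transpose_smul,
      Matrix.add_mul, Matrix.mul_add, Matrix.smul_mul, Matrix.mul_smul, Matrix.trace_add,
      Matrix.trace_smul, smul_eq_mul, cross, Matrix.trace_mul_comm Yᵀ Y,
      ← frobenius_norm_sq_eq_trace] at this
    linarith [sq_nonneg ‖X + t • Yᵀ‖]
  have := discrim_le_zero expansion
  rw [discrim] at this
  exact abs_le_of_sq_le_sq (by nlinarith) (by positivity)

variable [DecidableEq n]

theorem posDef_inv_mul_self {A : Matrix n n ℝ} (hA : A.PosDef) : A⁻¹ * A = 1 :=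
  Matrix.nonsing_inv_mul _ hA.det_pos.ne'.isUnit

theorem posDef_mul_inv_self {A : Matrix n n ℝ} (hA : A.PosDef) : A * A⁻¹ = 1 :=
  Matrix.mul_nonsing_inv _ hA.det_pos.ne'.isUnit

theorem trace_inv_mul_sub_mul_sub_transpose {K : Type*} [CommRing K] {R : Matrix n n K}
    (hR : Rᵀ = R) (hdet : IsUnit R.det) (M : Matrix n n K) :
    (R⁻¹ * ((M - R) * (M - R)ᵀ)).trace = (R⁻¹ * (M * Mᵀ)).trace - 2 * M.trace + R.trace := by
  have expansion : R⁻¹ * ((M - R) * (M - R)ᵀ) =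
      R⁻¹ * (M * Mᵀ) - R⁻¹ * M * R - R⁻¹ * R * Mᵀ + R⁻¹ * R * R := by
    rw [Matrix.transpose_sub, hR]
    noncomm_ring
  have cross : (R⁻¹ * M * R).trace = M.trace := by
    rw [Matrix.trace_mul_comm, ← Matrix.mul_assoc, Matrix.mul_nonsing_inv _ hdet, Matrix.one_mul]
  rw [expansion, Matrix.nonsing_inv_mul _ hdet, Matrix.one_mul, Matrix.one_mul, Matrix.trace_add,
    Matrix.trace_sub, Matrix.trace_sub, cross, Matrix.trace_transpose]
  ring

theorem two_mul_trace_le_trace_inv_mul_add_trace {R : Matrix n n ℝ} (hR : R.PosDef)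
    (M : Matrix n n ℝ) :
    2 * M.trace ≤ (R⁻¹ * (M * Mᵀ)).trace + R.trace := by
  have := trace_mul_mul_transpose_nonneg hR.inv.posSemidef (M - R)
  rw [trace_inv_mul_sub_mul_sub_transpose (Matrix.isHermitian_iff_isSymm.1 hR.isHermitian)
    hR.det_pos.ne'.isUnit] at this
  linarith

end TraceInequalities

section SquareRoot

variable {n : ℕ} {A B : Matrix (Fin n) (Fin n) ℝ}

open scoped MatrixOrder in
theorem matSqrt_eq_sqrt (hA : A.PosSemidef) : matSqrt A = CFC.sqrt A := by
  rw [CFC.sqrt_eq_real_sqrt A hA.nonneg, cfcₙ_eq_cfc (hf0 := Real.sqrt_zero)]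
  rfl

open scoped MatrixOrder in
theorem posSemidef_matSqrt (hA : A.PosSemidef) : (matSqrt A).PosSemidef := by
  rw [matSqrt_eq_sqrt hA]
  exact Matrix.nonneg_iff_posSemidef.1 (CFC.sqrt_nonneg A)

open scoped MatrixOrder in
theorem matSqrt_mul_self (hA : A.PosSemidef) : matSqrt A * matSqrt A = A := by
  rw [matSqrt_eq_sqrt hA]
  exact CFC.sqrt_mul_sqrt_self A hA.nonneg

open scoped MatrixOrder in
theorem matSqrt_eq_of_mul_self (hB : B.PosSemidef) (h : B * B = A) : matSqrt A = B := by
  have hA : A.PosSemidef := by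
    simpa only [(Matrix.isHermitian_iff_isSymm.1 hB.isHermitian).eq, h] using
      posSemidef_mul_transpose_self B
  rw [matSqrt_eq_sqrt hA]
  exact CFC.sqrt_unique h hB.nonneg

theorem transpose_matSqrt (hA : A.PosSemidef) : (matSqrt A)ᵀ = matSqrt A :=
  Matrix.isHermitian_iff_isSymm.1 (posSemidef_matSqrt hA).isHermitian

theorem matSqrt_mul_transpose (hA : A.PosSemidef) : matSqrt A * (matSqrt A)ᵀ = A := by
  rw [transpose_matSqrt hA, matSqrt_mul_self hA]

theorem posDef_matSqrt (hA : A.PosDef) : (matSqrt A).PosDef := by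
  rw [(posSemidef_matSqrt hA.posSemidef).posDef_iff_isUnit]
  exact isUnit_of_mul_isUnit_left ((matSqrt_mul_self hA.posSemidef).symm ▸ hA.isUnit)

theorem inv_matSqrt_mul (hA : A.PosDef) : (matSqrt A)⁻¹ * A = matSqrt A := by
  nth_rewrite 2 [← matSqrt_mul_self hA.posSemidef]
  rw [← Matrix.mul_assoc, posDef_inv_mul_self (posDef_matSqrt hA), Matrix.one_mul]

theorem matSqrt_mul_inv_mul_matSqrt (hA : A.PosDef) : matSqrt A * A⁻¹ * matSqrt A = 1 := by
  nth_rewrite 2 [← matSqrt_mul_self hA.posSemidef]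
  rw [Matrix.mul_inv_rev, ← Matrix.mul_assoc, posDef_mul_inv_self (posDef_matSqrt hA),
    Matrix.one_mul, posDef_inv_mul_self (posDef_matSqrt hA)]

theorem trace_le_trace_matSqrt (hM : (B * Bᵀ).PosDef) : B.trace ≤ (matSqrt (B * Bᵀ)).trace := by
  have := two_mul_trace_le_trace_inv_mul_add_trace (posDef_matSqrt hM) B
  rw [inv_matSqrt_mul hM] at this
  linarith

end SquareRoot

section SquareRootDerivative

open scoped MatrixOrder in
theorem exists_pos_mul_norm_sq_le_trace {n : Type*} [Fintype n] {A : Matrix n n ℝ}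
    (hA : A.PosDef) : ∃ c : ℝ, 0 < c ∧ ∀ X : Matrix n n ℝ, c * ‖X‖ ^ 2 ≤ (A * (X * Xᵀ)).trace := by
  classical
  cases isEmpty_or_nonempty n
  · exact ⟨1, one_pos, fun X => by simp [Subsingleton.elim X 0]⟩
  obtain ⟨c, hc, hcA⟩ := (CFC.exists_pos_algebraMap_le_iff hA.isHermitian).2 fun _ =>
    hA.isStrictlyPositive.spectrum_pos
  refine ⟨c, hc, fun X => ?_⟩
  have := trace_mul_mul_transpose_nonneg (Matrix.le_iff.1 hcA) X
  rw [Matrix.sub_mul, Matrix.trace_sub, Algebra.algebraMap_eq_smul_one c, Matrix.smul_mul,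
    Matrix.one_mul, Matrix.trace_smul, smul_eq_mul, ← frobenius_norm_sq_eq_trace] at this
  linarith

variable {n : ℕ} {A : Matrix (Fin n) (Fin n) ℝ}

theorem exists_norm_matSqrt_sub_le (hA : A.PosDef) :
    ∃ C : ℝ, ∀ B : Matrix (Fin n) (Fin n) ℝ, B.PosSemidef →
      ‖matSqrt B - matSqrt A‖ ≤ C * ‖B - A‖ := by
  obtain ⟨c, hc, hle⟩ := exists_pos_mul_norm_sq_le_trace (posDef_matSqrt hA)
  refine ⟨c⁻¹, fun B hB => ?_⟩
  set X := matSqrt B - matSqrt A with hX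
  have hXt : Xᵀ = X := by
    rw [hX, Matrix.transpose_sub, transpose_matSqrt hB, transpose_matSqrt hA.posSemidef]
  have hsub : B - A = matSqrt A * X + X * matSqrt B := by
    nth_rewrite 1 [← matSqrt_mul_self hA.posSemidef, ← matSqrt_mul_self hB]
    rw [hX]
    noncomm_ring
  have htrace : ((B - A) * X).trace =
      (matSqrt A * (X * Xᵀ)).trace + (matSqrt B * (X * Xᵀ)).trace := by
    rw [hXt, hsub, Matrix.add_mul, Matrix.trace_add, Matrix.mul_assoc, Matrix.mul_assoc,
      Matrix.trace_mul_comm X, Matrix.mul_assoc]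
  have hsq : c * ‖X‖ ^ 2 ≤ ‖B - A‖ * ‖X‖ := by
    linarith [hle X, trace_mul_mul_transpose_nonneg (posSemidef_matSqrt hB) X,
      le_abs_self ((B - A) * X).trace, abs_trace_mul_le (B - A) X]
  rw [inv_mul_eq_div, le_div_iff₀ hc]
  rcases (norm_nonneg X).eq_or_lt with h0 | h0
  · rw [← h0, zero_mul]
    positivity
  · nlinarith

theorem hasFDerivWithinAt_of_norm_sub_le_sq {𝕜 E F : Type*} [NontriviallyNormedField 𝕜]
    [NormedAddCommGroup E] [NormedSpace 𝕜 E] [NormedAddCommGroup F] [NormedSpace 𝕜 F] {f : E → F}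
    {L : E →L[𝕜] F} {s : Set E} {x : E} {C : ℝ}
    (h : ∀ y ∈ s, ‖f y - f x - L (y - x)‖ ≤ C * ‖y - x‖ ^ 2) : HasFDerivWithinAt f L s x := by
  have hbig : (fun y => f y - f x - L (y - x)) =O[𝓝[s] x] fun y => ‖y - x‖ ^ 2 :=
    .of_bound C (eventually_mem_nhdsWithin.mono fun y hy => by simpa using h y hy)
  exact hasFDerivWithinAt_iff_isLittleO.2 (hbig.trans_isLittleO
    ((Asymptotics.isLittleO_pow_sub_sub x one_lt_two).mono nhdsWithin_le_nhds))

/-- The linear functional `X ↦ tr (A X)`, through which gradients of functions of matrices are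
expressed. -/
noncomputable def traceMul {m n : Type*} [Fintype m] [Fintype n] (A : Matrix n m ℝ) :
    Matrix m n ℝ →L[ℝ] ℝ :=
  LinearMap.mkContinuous
    { toFun := fun X => (A * X).trace
      map_add' := fun X Y => by rw [Matrix.mul_add, Matrix.trace_add]
      map_smul' := fun c X => by rw [Matrix.mul_smul, Matrix.trace_smul, RingHom.id_apply] }
    ‖A‖ (abs_trace_mul_le A)

@[simp]
theorem traceMul_apply {m n : Type*} [Fintype m] [Fintype n] (A : Matrix n m ℝ)
    (X : Matrix m n ℝ) : traceMul A X = (A * X).trace := rfl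

theorem hasFDerivWithinAt_trace_matSqrt (hA : A.PosDef) :
    HasFDerivWithinAt (fun B => (matSqrt B).trace) ((1 / 2 : ℝ) • traceMul (matSqrt A)⁻¹)
      {B | B.PosSemidef} A := by
  obtain ⟨C, hlip⟩ := exists_norm_matSqrt_sub_le hA
  refine hasFDerivWithinAt_of_norm_sub_le_sq (C := 1 / 2 * ‖(matSqrt A)⁻¹‖ * C ^ 2)
    fun B hB => ?_
  have remainder : (matSqrt B).trace - (matSqrt A).trace -
      ((1 / 2 : ℝ) • traceMul (matSqrt A)⁻¹) (B - A) = -(1 / 2) *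
        ((matSqrt A)⁻¹ * ((matSqrt B - matSqrt A) * (matSqrt B - matSqrt A)ᵀ)).trace := by
    rw [trace_inv_mul_sub_mul_sub_transpose (transpose_matSqrt hA.posSemidef)
      (posDef_matSqrt hA).det_pos.ne'.isUnit, matSqrt_mul_transpose hB, smul_apply,
      traceMul_apply, Matrix.mul_sub, Matrix.trace_sub, inv_matSqrt_mul hA, smul_eq_mul]
    ring
  refine (congrArg norm remainder).trans_le ?_
  rw [norm_mul, norm_neg, Real.norm_of_nonneg one_half_pos.le, Real.norm_eq_abs, mul_assoc,
    mul_assoc, ← mul_pow]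
  gcongr
  set X := matSqrt B - matSqrt A
  calc |((matSqrt A)⁻¹ * (X * Xᵀ)).trace| ≤ ‖(matSqrt A)⁻¹‖ * (‖X‖ * ‖Xᵀ‖) :=
        (abs_trace_mul_le _ _).trans (by gcongr; exact Matrix.frobenius_norm_mul X Xᵀ)
    _ = ‖(matSqrt A)⁻¹‖ * ‖X‖ ^ 2 := by rw [Matrix.frobenius_norm_transpose, sq]
    _ ≤ ‖(matSqrt A)⁻¹‖ * (C * ‖B - A‖) ^ 2 := by gcongr; exact hlip B hB

end SquareRootDerivative

section BuresWasserstein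

variable {n : ℕ} {S₀ S U : Matrix (Fin n) (Fin n) ℝ}

/-- The fidelity `tr (S₀^{1/2} S S₀^{1/2})^{1/2}`, the nonlinear part of the Bures-Wasserstein
distance. -/
noncomputable def fidelity (S₀ S : Matrix (Fin n) (Fin n) ℝ) : ℝ :=
  (matSqrt (matSqrt S₀ * S * matSqrt S₀)).trace

/-- The matrix `S₀^{1/2} (S₀^{1/2} S S₀^{1/2})^{-1/2} S₀^{1/2}` of the optimal transport map from
the centred Gaussian measure of covariance `S` to that of covariance `S₀`. -/
noncomputable def transportMap (S₀ S : Matrix (Fin n) (Fin n) ℝ) : Matrix (Fin n) (Fin n) ℝ :=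
  matSqrt S₀ * (matSqrt (matSqrt S₀ * S * matSqrt S₀))⁻¹ * matSqrt S₀

theorem buresWassersteinSq_eq (S S₀ : Matrix (Fin n) (Fin n) ℝ) :
    buresWassersteinSq S S₀ = S.trace + S₀.trace - 2 * fidelity S₀ S := by
  rw [buresWassersteinSq, Matrix.trace_sub, Matrix.trace_add, Matrix.trace_smul, smul_eq_mul,
    fidelity]

theorem posSemidef_matSqrt_mul_mul_matSqrt (h₀ : S₀.PosSemidef) (h : S.PosSemidef) :
    (matSqrt S₀ * S * matSqrt S₀).PosSemidef := by
  simpa only [(posSemidef_matSqrt h₀).isHermitian.eq] using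
    h.mul_mul_conjTranspose_same (matSqrt S₀)

theorem posDef_matSqrt_mul_mul_matSqrt (h₀ : S₀.PosDef) (h : S.PosDef) :
    (matSqrt S₀ * S * matSqrt S₀).PosDef := by
  have hroot := posDef_matSqrt h₀
  have := h.conjTranspose_mul_mul_same (B := matSqrt S₀)
    (Matrix.mulVec_injective_of_isUnit hroot.isUnit)
  rwa [hroot.isHermitian.eq] at this

theorem transpose_transportMap (h₀ : S₀.PosSemidef) (h : S.PosSemidef) :
    (transportMap S₀ S)ᵀ = transportMap S₀ S := by
  rw [transportMap, Matrix.transpose_mul, Matrix.transpose_mul, Matrix.transpose_nonsing_inv,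
    transpose_matSqrt h₀, transpose_matSqrt (posSemidef_matSqrt_mul_mul_matSqrt h₀ h),
    ← Matrix.mul_assoc]

theorem transportMap_mul_mul_transportMap (h₀ : S₀.PosDef) (h : S.PosDef) :
    transportMap S₀ S * S * transportMap S₀ S = S₀ := by
  have hA := posDef_matSqrt_mul_mul_matSqrt h₀ h
  rw [transportMap]
  set H := matSqrt S₀
  set A := H * S * H with hAdef
  calc H * (matSqrt A)⁻¹ * H * S * (H * (matSqrt A)⁻¹ * H)
      = H * ((matSqrt A)⁻¹ * A * (matSqrt A)⁻¹) * H := by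
        rw [hAdef]; simp only [Matrix.mul_assoc]
    _ = S₀ := by
        rw [inv_matSqrt_mul hA, posDef_mul_inv_self (posDef_matSqrt hA), Matrix.mul_one,
          matSqrt_mul_self h₀.posSemidef]

theorem trace_matSqrt_mul_matSqrt_le_fidelity (h₀ : S₀.PosDef) (h : S.PosDef) :
    (matSqrt S₀ * matSqrt S).trace ≤ fidelity S₀ S := by
  have hfactor : matSqrt S₀ * S * matSqrt S₀ =
      matSqrt S₀ * matSqrt S * (matSqrt S₀ * matSqrt S)ᵀ := by
    rw [Matrix.transpose_mul, transpose_matSqrt h₀.posSemidef]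
    nth_rw 1 [← matSqrt_mul_transpose h.posSemidef]
    simp only [Matrix.mul_assoc]
  rw [fidelity, hfactor]
  exact trace_le_trace_matSqrt (hfactor ▸ posDef_matSqrt_mul_mul_matSqrt h₀ h)

theorem half_trace_sub_trace_le_buresWassersteinSq (h₀ : S₀.PosDef) (h : S.PosSemidef) :
    1 / 2 * S.trace - S₀.trace ≤ buresWassersteinSq S S₀ := by
  have hA := posSemidef_matSqrt_mul_mul_matSqrt h₀.posSemidef h
  have hle := two_mul_trace_le_trace_inv_mul_add_trace (h₀.smul (two_pos (α := ℝ)))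
    (matSqrt (matSqrt S₀ * S * matSqrt S₀))
  have hcancel : (S₀⁻¹ * (matSqrt S₀ * S * matSqrt S₀)).trace = S.trace := by
    rw [← Matrix.mul_assoc, Matrix.trace_mul_comm, ← Matrix.mul_assoc, ← Matrix.mul_assoc,
      matSqrt_mul_inv_mul_matSqrt h₀, Matrix.one_mul]
  rw [matSqrt_mul_transpose hA, Matrix.inv_smul _ (2 : ℝ) h₀.det_pos.ne'.isUnit,
    Matrix.smul_mul, Matrix.trace_smul, Matrix.trace_smul, hcancel] at hle
  rw [buresWassersteinSq_eq, fidelity]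
  simp only [invOf_eq_inv, smul_eq_mul] at hle
  linarith

theorem hasFDerivWithinAt_fidelity (h₀ : S₀.PosDef) (h : S.PosDef) :
    HasFDerivWithinAt (fidelity S₀) ((1 / 2 : ℝ) • traceMul (transportMap S₀ S))
      {S' | S'.PosSemidef} S := by
  let sandwich := LinearMap.toContinuousLinearMap
    (LinearMap.mulLeftRight ℝ (matSqrt S₀, matSqrt S₀))
  have hchain := (hasFDerivWithinAt_trace_matSqrt (posDef_matSqrt_mul_mul_matSqrt h₀ h)).comp
    (f := sandwich) S sandwich.hasFDerivWithinAt
    fun S' hS' => posSemidef_matSqrt_mul_mul_matSqrt h₀.posSemidef hS'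
  refine hchain.congr_fderiv (ContinuousLinearMap.ext fun X => ?_)
  change 1 / 2 * ((matSqrt _)⁻¹ * (matSqrt S₀ * X * matSqrt S₀)).trace =
    1 / 2 * (transportMap S₀ S * X).trace
  rw [transportMap, ← Matrix.mul_assoc, Matrix.trace_mul_comm]
  simp only [Matrix.mul_assoc]

theorem hasFDerivWithinAt_buresWassersteinSq (h₀ : S₀.PosDef) (h : S.PosDef) :
    HasFDerivWithinAt (fun S' => buresWassersteinSq S' S₀) (traceMul (1 - transportMap S₀ S))
      {S' | S'.PosSemidef} S := by
  have htrace : HasFDerivWithinAt Matrix.trace (traceMul (1 : Matrix (Fin n) (Fin n) ℝ))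
      {S' | S'.PosSemidef} S :=
    (traceMul 1).hasFDerivWithinAt.congr (fun X _ => by simp) (by simp)
  simp only [buresWassersteinSq_eq]
  refine ((htrace.add_const S₀.trace).sub
    ((hasFDerivWithinAt_fidelity h₀ h).const_mul 2)).congr_fderiv
      (ContinuousLinearMap.ext fun X => ?_)
  change (1 * X).trace - 2 * (1 / 2 * (transportMap S₀ S * X).trace) =
    ((1 - transportMap S₀ S) * X).trace
  rw [Matrix.sub_mul, Matrix.trace_sub]
  ring

theorem matSqrt_conj (hU : U ∈ Matrix.orthogonalGroup (Fin n) ℝ) (h : S.PosSemidef) :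
    matSqrt (U * S * Uᵀ) = U * matSqrt S * Uᵀ := by
  refine matSqrt_eq_of_mul_self ?_ ?_
  · simpa only [Matrix.conjTranspose_eq_transpose_of_trivial] using
      (posSemidef_matSqrt h).mul_mul_conjTranspose_same U
  · calc U * matSqrt S * Uᵀ * (U * matSqrt S * Uᵀ)
        = U * (matSqrt S * (Uᵀ * U) * matSqrt S) * Uᵀ := by simp only [Matrix.mul_assoc]
      _ = U * S * Uᵀ := by
        rw [(Matrix.mem_orthogonalGroup_iff' _ _).1 hU, Matrix.mul_one, matSqrt_mul_self h]

theorem fidelity_conj (hU : U ∈ Matrix.orthogonalGroup (Fin n) ℝ) (h₀ : S₀.PosSemidef)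
    (h : S.PosSemidef) : fidelity (U * S₀ * Uᵀ) (U * S * Uᵀ) = fidelity S₀ S := by
  have hUU : Uᵀ * U = 1 := (Matrix.mem_orthogonalGroup_iff' _ _).1 hU
  have hconj : U * matSqrt S₀ * Uᵀ * (U * S * Uᵀ) * (U * matSqrt S₀ * Uᵀ) =
      U * (matSqrt S₀ * S * matSqrt S₀) * Uᵀ := by
    calc _ = U * (matSqrt S₀ * (Uᵀ * U) * S * (Uᵀ * U) * matSqrt S₀) * Uᵀ := by
          simp only [Matrix.mul_assoc]
      _ = _ := by simp only [hUU, Matrix.mul_one]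
  rw [fidelity, fidelity, matSqrt_conj hU h₀, hconj,
    matSqrt_conj hU (posSemidef_matSqrt_mul_mul_matSqrt h₀ h), Matrix.trace_mul_comm,
    ← Matrix.mul_assoc, hUU, Matrix.one_mul]

theorem buresWassersteinSq_conj (hU : U ∈ Matrix.orthogonalGroup (Fin n) ℝ)
    (h₀ : S₀.PosSemidef) (h : S.PosSemidef) :
    buresWassersteinSq (U * S * Uᵀ) (U * S₀ * Uᵀ) = buresWassersteinSq S S₀ := by
  have htrace (X : Matrix (Fin n) (Fin n) ℝ) : (U * X * Uᵀ).trace = X.trace := by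
    rw [Matrix.trace_mul_comm, ← Matrix.mul_assoc, (Matrix.mem_orthogonalGroup_iff' _ _).1 hU,
      Matrix.one_mul]
  rw [buresWassersteinSq_eq, buresWassersteinSq_eq, fidelity_conj hU h₀ h, htrace, htrace]

end BuresWasserstein

section Loss

variable {n m : ℕ} {S₀ : Matrix (Fin n) (Fin n) ℝ} {τ : ℝ}

theorem posDef_mul_transpose_add_smul_one (hτ : 0 < τ) (W : Matrix (Fin n) (Fin m) ℝ) :
    (W * Wᵀ + τ • (1 : Matrix (Fin n) (Fin n) ℝ)).PosDef :=
  .posSemidef_add (posSemidef_mul_transpose_self W) (Matrix.PosDef.one.smul hτ)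

theorem hasFDerivAt_mul_transpose (W : Matrix (Fin n) (Fin m) ℝ) :
    ∃ L : Matrix (Fin n) (Fin m) ℝ →L[ℝ] Matrix (Fin n) (Fin n) ℝ,
      (∀ V, L V = W * Vᵀ + V * Wᵀ) ∧ HasFDerivAt (fun V => V * Vᵀ) L W := by
  let L : Matrix (Fin n) (Fin m) ℝ →L[ℝ] Matrix (Fin n) (Fin n) ℝ :=
    LinearMap.toContinuousLinearMap
      { toFun := fun V => W * Vᵀ + V * Wᵀ
        map_add' := fun V V' => by
          rw [Matrix.transpose_add, Matrix.mul_add, Matrix.add_mul]; abel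
        map_smul' := fun c V => by
          rw [Matrix.transpose_smul, Matrix.mul_smul, Matrix.smul_mul, smul_add,
            RingHom.id_apply] }
  refine ⟨L, fun V => rfl, hasFDerivWithinAt_univ.1
    (hasFDerivWithinAt_of_norm_sub_le_sq (C := 1) fun V _ => ?_)⟩
  have remainder : V * Vᵀ - W * Wᵀ - L (V - W) = (V - W) * (V - W)ᵀ := by
    change V * Vᵀ - W * Wᵀ - (W * (V - W)ᵀ + (V - W) * Wᵀ) = (V - W) * (V - W)ᵀ
    simp only [Matrix.transpose_sub, Matrix.mul_sub, Matrix.sub_mul]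
    abel
  refine (congrArg norm remainder).trans_le ((Matrix.frobenius_norm_mul _ _).trans_eq ?_)
  rw [Matrix.frobenius_norm_transpose, one_mul, sq]

theorem hasFDerivAt_funcLoss (h₀ : S₀.PosDef) (hτ : 0 < τ) (W : Matrix (Fin n) (Fin m) ℝ) :
    HasFDerivAt (funcLoss S₀ τ)
      ((2 : ℝ) • traceMul (Wᵀ * (1 - transportMap S₀ (W * Wᵀ + τ • 1)))) W := by
  have hS := posDef_mul_transpose_add_smul_one hτ W
  obtain ⟨L, hL, hgram⟩ := hasFDerivAt_mul_transpose W
  have hchain := (hasFDerivWithinAt_buresWassersteinSq h₀ hS).comp_hasFDerivAt W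
    (hgram.add_const (τ • 1)) (.of_forall fun V =>
      (posDef_mul_transpose_add_smul_one hτ V).posSemidef)
  refine hchain.congr_fderiv (ContinuousLinearMap.ext fun V => ?_)
  have hT := transpose_transportMap h₀.posSemidef hS.posSemidef
  change ((1 - transportMap S₀ (W * Wᵀ + τ • 1)) * L V).trace =
    2 * (Wᵀ * (1 - transportMap S₀ (W * Wᵀ + τ • 1)) * V).trace
  set A := 1 - transportMap S₀ (W * Wᵀ + τ • 1) with hA
  have hAt : Aᵀ = A := by rw [hA, Matrix.transpose_sub, Matrix.transpose_one, hT]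
  have hflip : (A * (W * Vᵀ)).trace = (A * (V * Wᵀ)).trace := by
    rw [← Matrix.trace_transpose, Matrix.transpose_mul, Matrix.transpose_mul,
      Matrix.transpose_transpose, hAt, Matrix.trace_mul_comm]
  have hcycle : (A * (V * Wᵀ)).trace = (Wᵀ * A * V).trace := by
    rw [← Matrix.mul_assoc, Matrix.trace_mul_comm, Matrix.mul_assoc]
  rw [hL, Matrix.mul_add, Matrix.trace_add, hflip, hcycle, two_mul]

end Loss

section GeneralizedInverse

variable {K m n l : Type*} [Field K] [Fintype n]

theorem exists_mul_mul_self_eq_self [Fintype m] (W : Matrix m n K) :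
    ∃ G : Matrix n m K, W * G * W = W := by
  classical
  let f := W.mulVecLin
  obtain ⟨h, hh⟩ := f.rangeRestrict.exists_rightInverse_of_surjective f.range_rangeRestrict
  obtain ⟨g, hg⟩ := h.exists_extend
  have hfgf (x) : f (g (f x)) = f x := by
    have hg' : g (f x) = h (f.rangeRestrict x) := LinearMap.congr_fun hg (f.rangeRestrict x)
    rw [hg']
    exact congrArg Subtype.val (LinearMap.congr_fun hh (f.rangeRestrict x))
  refine ⟨LinearMap.toMatrix' g, Matrix.mulVec_injective (funext fun x => ?_)⟩
  rw [← Matrix.mulVec_mulVec, ← Matrix.mulVec_mulVec, LinearMap.toMatrix'_mulVec]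
  exact hfgf x

theorem exists_eq_mul_mul_of_rank_le [Fintype l] {A : Matrix m n K} {B : Matrix n l K}
    (h : A.rank ≤ (A * B).rank) : ∃ Z : Matrix l n K, A = A * B * Z := by
  classical
  have hrange : LinearMap.range (A * B).mulVecLin = LinearMap.range A.mulVecLin :=
    Submodule.eq_of_le_of_finrank_le
      (by rw [Matrix.mulVecLin_mul]; exact LinearMap.range_comp_le_range _ _) h
  have hcol (j : n) : A.col j ∈ LinearMap.range (A * B).mulVecLin :=
    hrange ▸ ⟨Pi.single j 1, Matrix.mulVec_single_one A j⟩
  choose z hz using hcol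
  refine ⟨(Matrix.of z)ᵀ, Matrix.ext fun i j => ?_⟩
  exact (congrFun (hz j) i).symm

theorem mul_mul_eq_of_rank_le [Fintype m] [DecidableEq m] [DecidableEq n] {W W' : Matrix m n K}
    {G : Matrix n m K} {P : Matrix m m K}
    (hG : W * G * W = W) (hP : P = 1 + (W' - W) * G) (hdet : IsUnit P.det)
    (hrank : W'.rank ≤ W.rank) : P * W * (1 + G * P⁻¹ * W' - G * W) = W' := by
  have hPW : P * W = W' * (G * W) := by
    rw [hP, Matrix.add_mul, Matrix.sub_mul, Matrix.sub_mul, hG, Matrix.one_mul, Matrix.mul_assoc]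
    abel
  -- `W' G W = P W` has the rank of `W`, so it has the same column space as `W'`.
  obtain ⟨Z, hZ⟩ : ∃ Z : Matrix n n K, W' = W' * (G * W) * Z :=
    exists_eq_mul_mul_of_rank_le (by rwa [← hPW, Matrix.rank_mul_eq_right_of_isUnit_det P W hdet])
  have hinv : P⁻¹ * W' = W * Z := by
    rw [hZ, ← hPW, Matrix.mul_assoc, Matrix.nonsing_inv_mul_cancel_left _ _ hdet]
  calc P * W * (1 + G * P⁻¹ * W' - G * W)
      = P * (W + W * G * (P⁻¹ * W') - W * G * W) := by
        simp only [Matrix.mul_assoc, Matrix.mul_add, Matrix.mul_sub, Matrix.mul_one]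
    _ = P * W * Z := by
        rw [hinv, ← Matrix.mul_assoc (W * G), hG, add_sub_cancel_left, Matrix.mul_assoc]
    _ = W' := by rw [hPW, ← hZ]

end GeneralizedInverse

section DifferentiableMatrix

theorem isBoundedBilinearMap_matrix_mul {l m n : Type*} [Fintype l] [Fintype m] [Fintype n] :
    IsBoundedBilinearMap ℝ fun p : Matrix l m ℝ × Matrix m n ℝ => p.1 * p.2 where
  add_left _ _ _ := Matrix.add_mul _ _ _
  smul_left _ _ _ := Matrix.smul_mul _ _ _
  add_right _ _ _ := Matrix.mul_add _ _ _
  smul_right _ _ _ := Matrix.mul_smul _ _ _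
  bound := ⟨1, one_pos, fun A B => by simpa only [one_mul] using Matrix.frobenius_norm_mul A B⟩

variable {E : Type*} [NormedAddCommGroup E] [NormedSpace ℝ E] {x : E}

theorem differentiableAt_matrix_mul {l m n : Type*} [Finite l] [Fintype m] [Finite n]
    {A : E → Matrix l m ℝ} {B : E → Matrix m n ℝ} (hA : DifferentiableAt ℝ A x)
    (hB : DifferentiableAt ℝ B x) : DifferentiableAt ℝ (fun y => A y * B y) x := by
  have := Fintype.ofFinite l
  have := Fintype.ofFinite n
  exact (isBoundedBilinearMap_matrix_mul.differentiableAt (A x, B x)).comp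
    (f := fun y => (A y, B y)) x (hA.prodMk hB)

attribute [local instance] Matrix.frobeniusNormedRing Matrix.frobeniusNormedAlgebra in
theorem differentiableAt_matrix_inv {n : Type*} [Fintype n] [DecidableEq n] {A : E → Matrix n n ℝ}
    (hA : DifferentiableAt ℝ A x) (hdet : IsUnit (A x).det) :
    DifferentiableAt ℝ (fun y => (A y)⁻¹) x := by
  simp only [Matrix.nonsing_inv_eq_ringInverse]
  exact (differentiableAt_inverse (𝕜 := ℝ) ((Matrix.isUnit_iff_isUnit_det _).2 hdet)).comp x hA

end DifferentiableMatrix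

section RankStrata

variable {m n : Type*} [Fintype m]

section

variable [Finite n]

theorem isOpen_le_rank (k : ℕ) : IsOpen {W : Matrix n m ℝ | k ≤ W.rank} := by
  classical
  have := Fintype.ofFinite n
  let Φ : Matrix n m ℝ →ₗ[ℝ] (m → ℝ) →L[ℝ] (n → ℝ) :=
    (LinearMap.toContinuousLinearMap (𝕜 := ℝ)).toLinearMap ∘ₗ Matrix.toLin'.toLinearMap
  have hrank (W : Matrix n m ℝ) : (W.rank : Cardinal) = LinearMap.rank W.mulVecLin :=
    Module.finrank_eq_rank _ _
  have hset : {W : Matrix n m ℝ | k ≤ W.rank} =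
      {W | (k : Cardinal) ≤ LinearMap.rank W.mulVecLin} :=
    Set.ext fun W => by rw [Set.mem_ofPred_eq, Set.mem_ofPred_eq, ← hrank, Nat.cast_le]
  rw [hset]
  exact (isOpen_setOfPred_nat_le_rank (𝕜 := ℝ) k).preimage Φ.continuous_of_finiteDimensional

theorem isClosed_rank_le (k : ℕ) : IsClosed {W : Matrix n m ℝ | W.rank ≤ k} := by
  simpa only [Set.compl_ofPred, not_le, Nat.lt_succ_iff] using
    (isOpen_le_rank (k + 1)).isClosed_compl

end

variable [Fintype n]

theorem exists_differentiableAt_mul_mul_eq [DecidableEq m] [DecidableEq n]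
    (W : Matrix n m ℝ) :
    ∃ (P : Matrix n m ℝ → Matrix n n ℝ) (Q : Matrix n m ℝ → Matrix m m ℝ),
      DifferentiableAt ℝ P W ∧ DifferentiableAt ℝ Q W ∧ P W = 1 ∧ Q W = 1 ∧
        ∀ᶠ W' in 𝓝 W, W'.rank ≤ W.rank → P W' * W * Q W' = W' := by
  obtain ⟨G, hG⟩ := exists_mul_mul_self_eq_self W
  let P := fun W' : Matrix n m ℝ => 1 + (W' - W) * G
  have hPW : P W = 1 := by simp [P]
  have hdet : IsUnit (P W).det := by simp [hPW]
  have hP : DifferentiableAt ℝ P W :=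
    (differentiableAt_matrix_mul (differentiableAt_id.sub_const W)
      (differentiableAt_const G)).const_add 1
  have hQ : DifferentiableAt ℝ (fun W' => 1 + G * (P W')⁻¹ * W' - G * W) W :=
    ((differentiableAt_matrix_mul (differentiableAt_matrix_mul (differentiableAt_const G)
      (differentiableAt_matrix_inv hP hdet)) differentiableAt_id).const_add 1).sub_const (G * W)
  refine ⟨P, fun W' => 1 + G * (P W')⁻¹ * W' - G * W, hP, hQ, hPW, by simp [hPW], ?_⟩
  have hinv : ∀ᶠ W' in 𝓝 W, (P W').det ≠ 0 :=
    (continuous_id.matrix_det.continuousAt.comp hP.continuousAt).eventually_ne hdet.ne_zero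
  filter_upwards [hinv] with W' hW' hrank
  exact mul_mul_eq_of_rank_le hG rfl hW'.isUnit hrank

theorem eventually_rank_one_add_smul_mul_eq [DecidableEq n] (A : Matrix n n ℝ)
    (W : Matrix n m ℝ) : ∀ᶠ t : ℝ in 𝓝 0, ((1 + t • A) * W).rank = W.rank := by
  have hdet : Continuous fun t : ℝ => (1 + t • A).det :=
    (continuous_const.add (continuous_id.smul continuous_const)).matrix_det
  have hne : ∀ᶠ t : ℝ in 𝓝 0, (1 + t • A).det ≠ 0 :=
    hdet.continuousAt.eventually_ne (by simp)
  filter_upwards [hne] with t ht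
  exact Matrix.rank_mul_eq_right_of_isUnit_det _ _ ht.isUnit

theorem hasFDerivAt_mul_eq_zero_of_isLocalMinOn_rankManifold {n m : ℕ}
    {W : Matrix (Fin n) (Fin m) ℝ} {f : Matrix (Fin n) (Fin m) ℝ → ℝ}
    {f' : Matrix (Fin n) (Fin m) ℝ →L[ℝ] ℝ} (hf : HasFDerivAt f f' W)
    (hmin : IsLocalMinOn f (rankManifold n m W.rank) W) (A : Matrix (Fin n) (Fin n) ℝ) :
    f' (A * W) = 0 := by
  let γ := fun t : ℝ => W + t • (A * W)
  have hγ : HasDerivAt γ (A * W) 0 := by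
    simpa only [one_smul] using! ((hasDerivAt_id (0 : ℝ)).smul_const (A * W)).const_add W
  have hγ0 : γ 0 = W := by simp [γ]
  have hγrank : ∀ᶠ t in 𝓝 0, γ t ∈ rankManifold n m W.rank := by
    filter_upwards [eventually_rank_one_add_smul_mul_eq A W] with t ht
    rwa [Matrix.add_mul, Matrix.one_mul, Matrix.smul_mul] at ht
  have hγlim : Filter.Tendsto γ (𝓝 0) (𝓝[rankManifold n m W.rank] W) :=
    tendsto_nhdsWithin_iff.2 ⟨hγ0 ▸ hγ.continuousAt, hγrank⟩
  have hlocal : IsLocalMin (f ∘ γ) 0 := by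
    filter_upwards [hγlim.eventually hmin] with t ht
    simpa only [Function.comp_apply, hγ0] using ht
  exact hlocal.hasDerivAt_eq_zero (HasFDerivAt.comp_hasDerivAt 0 (hγ0.symm ▸ hf) hγ)

end RankStrata

section DeepNetwork

variable {d : ℕ → ℕ} {N : ℕ}

/-- The weight matrix of the first layer. -/
def firstLayer (θ : Params d (N + 1)) : Matrix (Fin (d 1)) (Fin (d 0)) ℝ :=
  θ 0

/-- The network without its last layer. -/
def initLayers (θ : Params d (N + 1)) : Params d N :=
  fun j => θ j.castSucc

/-- The parameters obtained from `θ` by multiplying the last weight matrix by `P` on the left. -/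
def mulLastLayer (P : Matrix (Fin (d (N + 1))) (Fin (d (N + 1))) ℝ) (θ : Params d (N + 1)) :
    Params d (N + 1) :=
  Function.update θ (Fin.last N) (P * lastLayer θ)

/-- The parameters obtained from `θ` by multiplying the first weight matrix by `Q` on the right. -/
def firstLayerMul (θ : Params d (N + 1)) (Q : Matrix (Fin (d 0)) (Fin (d 0)) ℝ) :
    Params d (N + 1) :=
  Function.update θ 0 (firstLayer θ * Q)

theorem one_mulLastLayer (θ : Params d (N + 1)) : mulLastLayer 1 θ = θ := by
  rw [mulLastLayer, Matrix.one_mul]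
  exact Function.update_eq_self _ _

theorem firstLayerMul_one (θ : Params d (N + 1)) : firstLayerMul θ 1 = θ := by
  rw [firstLayerMul, Matrix.mul_one]
  exact Function.update_eq_self _ _

theorem firstLayerMul_of_ne (θ : Params d (N + 1)) (Q : Matrix (Fin (d 0)) (Fin (d 0)) ℝ)
    {j : Fin (N + 1)} (hj : j ≠ 0) : firstLayerMul θ Q j = θ j :=
  Function.update_of_ne hj _ _

theorem endToEnd_succ (θ : Params d (N + 1)) :
    endToEnd d (N + 1) θ = lastLayer θ * endToEnd d N (initLayers θ) := rfl

theorem endToEnd_mulLastLayer (P : Matrix (Fin (d (N + 1))) (Fin (d (N + 1))) ℝ)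
    (θ : Params d (N + 1)) :
    endToEnd d (N + 1) (mulLastLayer P θ) = P * endToEnd d (N + 1) θ := by
  have hlast : lastLayer (mulLastLayer P θ) = P * lastLayer θ := Function.update_self _ _ _
  have hinit : initLayers (mulLastLayer P θ) = initLayers θ :=
    funext fun j => Function.update_of_ne j.castSucc_lt_last.ne _ _
  rw [endToEnd_succ, endToEnd_succ, hlast, hinit, Matrix.mul_assoc]

theorem endToEnd_firstLayerMul (θ : Params d (N + 1)) (Q : Matrix (Fin (d 0)) (Fin (d 0)) ℝ) :
    endToEnd d (N + 1) (firstLayerMul θ Q) = endToEnd d (N + 1) θ * Q := by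
  induction N with
  | zero =>
    have hlast : lastLayer (firstLayerMul θ Q) = firstLayer θ * Q :=
      Function.update_self (0 : Fin 1) _ θ
    rw [endToEnd_succ, endToEnd_succ, hlast]
    exact (Matrix.mul_one _).trans (congrArg (· * Q) (Matrix.mul_one (firstLayer θ)).symm)
  | succ N ih =>
    have hlast : lastLayer (firstLayerMul θ Q) = lastLayer θ :=
      firstLayerMul_of_ne θ Q Fin.last_pos.ne'
    have hinit : initLayers (firstLayerMul θ Q) = firstLayerMul (initLayers θ) Q := by
      funext j
      rcases eq_or_ne j 0 with rfl | hj
      · rfl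
      · exact (firstLayerMul_of_ne θ Q (Fin.castSucc_ne_zero_iff.2 hj)).trans
          (firstLayerMul_of_ne (initLayers θ) Q hj).symm
    rw [endToEnd_succ (N := N + 1), endToEnd_succ θ, hlast, hinit, ih, Matrix.mul_assoc]

theorem rank_endToEnd_le (θ : Params d N) {j : ℕ} (hj : j ≤ N) : (endToEnd d N θ).rank ≤ d j := by
  induction N with
  | zero =>
    obtain rfl := Nat.le_zero.1 hj
    exact Matrix.rank_le_width _
  | succ N ih =>
    rcases hj.eq_or_lt with rfl | hj
    · exact Matrix.rank_le_height _
    · exact (Matrix.rank_mul_le_right _ _).trans (ih _ (Nat.lt_succ_iff.1 hj))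

theorem rank_endToEnd_le_minWidth (θ : Params d N) : (endToEnd d N θ).rank ≤ minWidth d N :=
  Finset.le_inf' _ _ fun _ hj => rank_endToEnd_le θ (Finset.mem_range_succ_iff.1 hj)

theorem differentiable_endToEnd (d : ℕ → ℕ) (N : ℕ) : Differentiable ℝ (endToEnd d N) := by
  induction N with
  | zero => exact differentiable_const _
  | succ N ih =>
    have hlayer (j : Fin (N + 1)) : Differentiable ℝ fun θ : Params d (N + 1) => θ j :=
      differentiable_pi.1 differentiable_id j
    have hinit : Differentiable ℝ (initLayers (d := d) (N := N)) :=
      differentiable_pi.2 fun j => hlayer j.castSucc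
    exact fun θ => differentiableAt_matrix_mul (hlayer (Fin.last N) θ) ((ih.comp hinit) θ)

variable {E : Type*} [NormedAddCommGroup E] [NormedSpace ℝ E] {x : E}

theorem differentiableAt_function_update {ι : Type*} [Finite ι] [DecidableEq ι] {F : ι → Type*}
    [∀ i, NormedAddCommGroup (F i)] [∀ i, NormedSpace ℝ (F i)] {f : E → ∀ i, F i} {i : ι}
    {g : E → F i} (hf : DifferentiableAt ℝ f x) (hg : DifferentiableAt ℝ g x) :
    DifferentiableAt ℝ (fun y => Function.update (f y) i (g y)) x := by
  have := Fintype.ofFinite ι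
  refine differentiableAt_pi.2 fun j => ?_
  rcases eq_or_ne j i with rfl | hj
  · simpa only [Function.update_self] using hg
  · simpa only [Function.update_of_ne hj] using differentiableAt_pi.1 hf j

theorem differentiableAt_mulLastLayer {P : E → Matrix (Fin (d (N + 1))) (Fin (d (N + 1))) ℝ}
    {t : E → Params d (N + 1)} (hP : DifferentiableAt ℝ P x) (ht : DifferentiableAt ℝ t x) :
    DifferentiableAt ℝ (fun y => mulLastLayer (P y) (t y)) x :=
  differentiableAt_function_update ht
    (differentiableAt_matrix_mul hP (differentiableAt_pi.1 ht (Fin.last N)))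

theorem differentiableAt_firstLayerMul {t : E → Params d (N + 1)}
    {Q : E → Matrix (Fin (d 0)) (Fin (d 0)) ℝ} (ht : DifferentiableAt ℝ t x)
    (hQ : DifferentiableAt ℝ Q x) :
    DifferentiableAt ℝ (fun y => firstLayerMul (t y) (Q y)) x :=
  differentiableAt_function_update ht (differentiableAt_matrix_mul (differentiableAt_pi.1 ht 0) hQ)

theorem exists_differentiableAt_endToEnd_eq (θ : Params d (N + 1)) :
    ∃ s : Matrix (Fin (d (N + 1))) (Fin (d 0)) ℝ → Params d (N + 1),
      DifferentiableAt ℝ s (endToEnd d (N + 1) θ) ∧ s (endToEnd d (N + 1) θ) = θ ∧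
      ∀ᶠ W in 𝓝 (endToEnd d (N + 1) θ), W.rank ≤ (endToEnd d (N + 1) θ).rank →
        endToEnd d (N + 1) (s W) = W := by
  obtain ⟨P, Q, hP, hQ, hPone, hQone, hPQ⟩ :=
    exists_differentiableAt_mul_mul_eq (endToEnd d (N + 1) θ)
  refine ⟨fun W => firstLayerMul (mulLastLayer (P W) θ) (Q W),
    differentiableAt_firstLayerMul (differentiableAt_mulLastLayer hP (differentiableAt_const θ)) hQ,
    by simp only [hPone, hQone, one_mulLastLayer, firstLayerMul_one], ?_⟩
  simpa only [endToEnd_firstLayerMul, endToEnd_mulLastLayer] using hPQ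

end DeepNetwork

section CriticalPoints

theorem isCriticalPointOn_of_hasFDerivWithinAt_zero {E : Type*} [NormedAddCommGroup E]
    [NormedSpace ℝ E] {f : E → ℝ} {M : Set E} {x : E} (hx : x ∈ M) (hf : DifferentiableOn ℝ f M)
    (h : HasFDerivWithinAt f (0 : E →L[ℝ] ℝ) M x) : IsCriticalPointOn f M x := by
  refine ⟨hx, hf, ?_⟩
  rintro v ⟨γ, hγ, hγM, rfl, rfl⟩
  have hγ' : HasDerivAt γ (deriv γ 0) 0 := (hγ.differentiableAt (by simp)).hasDerivAt
  have hcomp {L : E →L[ℝ] ℝ} (hL : HasFDerivWithinAt f L M (γ 0)) :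
      HasDerivAt (f ∘ γ) (L (deriv γ 0)) 0 :=
    (hL.comp_hasDerivWithinAt (s := {t | γ t ∈ M}) 0 hγ'.hasDerivWithinAt fun _ ht => ht).hasDerivAt
      hγM
  exact (hcomp (hf (γ 0) hx).hasFDerivWithinAt).unique (hcomp h)

theorem hasFDerivWithinAt_zero_of_section {𝕜 E F G : Type*} [NontriviallyNormedField 𝕜]
    [NormedAddCommGroup E] [NormedSpace 𝕜 E] [NormedAddCommGroup F] [NormedSpace 𝕜 F]
    [NormedAddCommGroup G] [NormedSpace 𝕜 G] {f : E → G} {g : F → G} {s : E → F} {M : Set E}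
    {x : E} (hx : x ∈ M) (hs : DifferentiableAt 𝕜 s x)
    (hg : HasFDerivAt g (0 : F →L[𝕜] G) (s x)) (h : ∀ᶠ y in 𝓝 x, y ∈ M → g (s y) = f y) :
    HasFDerivWithinAt f (0 : E →L[𝕜] G) M x := by
  have hgs : HasFDerivAt (g ∘ s) (0 : E →L[𝕜] G) x := by
    simpa only [ContinuousLinearMap.zero_comp] using hg.comp x hs.hasFDerivAt
  refine hgs.hasFDerivWithinAt.congr_of_eventuallyEq ?_ (h.self_of_nhds hx).symm
  filter_upwards [nhdsWithin_le_nhds h, self_mem_nhdsWithin] with y hy hyM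
  exact (hy hyM).symm

theorem isLocalMin_paramLoss_of_isLocalMinOn_funcLoss {d : ℕ → ℕ} {N : ℕ}
    {S₀ : Matrix (Fin (d N)) (Fin (d N)) ℝ} {τ : ℝ} {θ : Params d N}
    (hθ : (endToEnd d N θ).rank = minWidth d N)
    (h : IsLocalMinOn (funcLoss S₀ τ) (rankManifold (d N) (d 0) (minWidth d N))
      (endToEnd d N θ)) :
    IsLocalMin (paramLoss d N S₀ τ) θ := by
  have hcont : ContinuousAt (endToEnd d N) θ :=
    (differentiable_endToEnd d N θ).continuousAt
  have hrank : ∀ᶠ θ' in 𝓝 θ, minWidth d N ≤ (endToEnd d N θ').rank :=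
    hcont.eventually ((isOpen_le_rank _).mem_nhds hθ.ge)
  exact (tendsto_nhdsWithin_iff.2 ⟨hcont, hrank.mono fun θ' hθ' =>
    (rank_endToEnd_le_minWidth θ').antisymm hθ'⟩).eventually h

variable {d : ℕ → ℕ} {N : ℕ} {S₀ : Matrix (Fin (d (N + 1))) (Fin (d (N + 1))) ℝ} {τ : ℝ}
  {θ : Params d (N + 1)}

theorem isCriticalPointOn_of_isCriticalPoint (h₀ : S₀.PosDef) (hτ : 0 < τ)
    (h : IsCriticalPoint (paramLoss d (N + 1) S₀ τ) θ) :
    IsCriticalPointOn (funcLoss S₀ τ)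
      (rankManifold (d (N + 1)) (d 0) (endToEnd d (N + 1) θ).rank) (endToEnd d (N + 1) θ) := by
  obtain ⟨s, hs, hsθ, hsection⟩ := exists_differentiableAt_endToEnd_eq θ
  refine isCriticalPointOn_of_hasFDerivWithinAt_zero rfl
    (fun W _ => (hasFDerivAt_funcLoss h₀ hτ W).differentiableAt.differentiableWithinAt)
    (hasFDerivWithinAt_zero_of_section (g := paramLoss d (N + 1) S₀ τ) rfl hs (hsθ.symm ▸ h) ?_)
  filter_upwards [hsection] with W hW hrank
  rw [paramLoss, hW (le_of_eq hrank)]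

theorem isLocalMinOn_funcLoss_of_isLocalMin_paramLoss
    (h : IsLocalMin (paramLoss d (N + 1) S₀ τ) θ) :
    IsLocalMinOn (funcLoss S₀ τ)
      (rankManifold (d (N + 1)) (d 0) (endToEnd d (N + 1) θ).rank) (endToEnd d (N + 1) θ) := by
  obtain ⟨s, hs, hsθ, hsection⟩ := exists_differentiableAt_endToEnd_eq θ
  have hlim : Filter.Tendsto s (𝓝 (endToEnd d (N + 1) θ)) (𝓝 θ) := by
    simpa only [hsθ] using hs.continuousAt.tendsto
  filter_upwards [nhdsWithin_le_nhds (hlim.eventually h), nhdsWithin_le_nhds hsection,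
    self_mem_nhdsWithin] with W hmin hW hrank
  rwa [paramLoss, paramLoss, hW (le_of_eq hrank)] at hmin

end CriticalPoints

section Diagonal

variable {n : Type*} [Fintype n] [DecidableEq n]

theorem exists_eq_diagonal_of_commute_diagonal {R : Type*} [CommRing R] [NoZeroDivisors R]
    {a : n → R} (ha : Function.Injective a) {K : Matrix n n R}
    (h : Commute (Matrix.diagonal a) K) : ∃ s, K = Matrix.diagonal s := by
  refine ⟨K.diag, Matrix.ext fun i j => ?_⟩
  rcases eq_or_ne i j with rfl | hij
  · rw [Matrix.diagonal_apply_eq, Matrix.diag_apply]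
  · have hentry := congrFun (congrFun h i) j
    rw [Matrix.mul_diagonal, Matrix.diagonal_mul, mul_comm, ← sub_eq_zero, ← mul_sub] at hentry
    rw [Matrix.diagonal_apply_ne _ hij]
    exact (mul_eq_zero.1 hentry).resolve_right (sub_ne_zero.2 fun h => hij (ha h))

end Diagonal

section DiagonalBuresWasserstein

variable {n : ℕ} {a b : Fin n → ℝ}

theorem matSqrt_diagonal (ha : ∀ i, 0 ≤ a i) :
    matSqrt (Matrix.diagonal a) = Matrix.diagonal fun i => √(a i) := by
  refine matSqrt_eq_of_mul_self (.diagonal fun i => Real.sqrt_nonneg _) ?_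
  rw [Matrix.diagonal_mul_diagonal]
  exact congrArg Matrix.diagonal (funext fun i => Real.mul_self_sqrt (ha i))

theorem fidelity_diagonal (ha : ∀ i, 0 ≤ a i) (hb : ∀ i, 0 ≤ b i) :
    fidelity (Matrix.diagonal a) (Matrix.diagonal b) = ∑ i, √(a i) * √(b i) := by
  have hab (i) : √(a i) * b i * √(a i) = a i * b i := by
    linear_combination b i * Real.mul_self_sqrt (ha i)
  simp only [fidelity, matSqrt_diagonal ha, Matrix.diagonal_mul_diagonal, hab]
  rw [matSqrt_diagonal fun i => mul_nonneg (ha i) (hb i), Matrix.trace_diagonal]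
  exact Finset.sum_congr rfl fun i _ => Real.sqrt_mul (ha i) _

theorem buresWassersteinSq_diagonal (ha : ∀ i, 0 ≤ a i) (hb : ∀ i, 0 ≤ b i) :
    buresWassersteinSq (Matrix.diagonal b) (Matrix.diagonal a) = ∑ i, (√(a i) - √(b i)) ^ 2 := by
  rw [buresWassersteinSq_eq, fidelity_diagonal ha hb, Matrix.trace_diagonal,
    Matrix.trace_diagonal, Finset.mul_sum, ← Finset.sum_add_distrib, ← Finset.sum_sub_distrib]
  refine Finset.sum_congr rfl fun i _ => ?_
  rw [sub_sq, Real.sq_sqrt (ha i), Real.sq_sqrt (hb i)]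
  ring

end DiagonalBuresWasserstein

section PlaneRotation

variable {n : Type*} [DecidableEq n] {i j : n}

/-- The rotation by the angle `φ` in the plane of the coordinates `i` and `j`, given by its
rows. -/
noncomputable def planeRotation (i j : n) (φ : ℝ) : Matrix n n ℝ :=
  Matrix.of fun p =>
    if p = i then Real.cos φ • Pi.single i 1 + Real.sin φ • Pi.single j 1
    else if p = j then Real.cos φ • Pi.single j 1 - Real.sin φ • Pi.single i 1
    else Pi.single p 1

theorem planeRotation_left (i j : n) (φ : ℝ) :
    planeRotation i j φ i = Real.cos φ • Pi.single i 1 + Real.sin φ • Pi.single j 1 :=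
  if_pos rfl

theorem planeRotation_right (hij : i ≠ j) (φ : ℝ) :
    planeRotation i j φ j = Real.cos φ • Pi.single j 1 - Real.sin φ • Pi.single i 1 :=
  (if_neg hij.symm).trans (if_pos rfl)

theorem planeRotation_of_ne {p : n} (hi : p ≠ i) (hj : p ≠ j) (φ : ℝ) :
    planeRotation i j φ p = Pi.single p 1 :=
  (if_neg hi).trans (if_neg hj)

theorem planeRotation_zero (hij : i ≠ j) : planeRotation i j 0 = 1 := by
  have hrow (p : n) : planeRotation i j 0 p = Pi.single p 1 := by
    obtain rfl | rfl | ⟨hi, hj⟩ : i = p ∨ j = p ∨ p ≠ i ∧ p ≠ j := by tauto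
    · simp [planeRotation_left]
    · simp [planeRotation_right hij]
    · exact planeRotation_of_ne hi hj 0
  exact Matrix.ext fun p q => (congrFun (hrow p) q).trans Matrix.one_eq_pi_single.symm

theorem continuous_planeRotation (i j : n) : Continuous (planeRotation i j) := by
  refine continuous_pi fun p => ?_
  change Continuous fun φ => if p = i then _ else _
  split_ifs <;> fun_prop

variable [Fintype n]

theorem planeRotation_mem_orthogonalGroup (hij : i ≠ j) (φ : ℝ) :
    planeRotation i j φ ∈ Matrix.orthogonalGroup n ℝ := by
  refine (Matrix.mem_orthogonalGroup_iff _ _).2 (Matrix.ext fun p q => ?_)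
  change planeRotation i j φ p ⬝ᵥ planeRotation i j φ q = _
  have hφ := Real.cos_sq_add_sin_sq φ
  obtain rfl | rfl | ⟨hpi, hpj⟩ : i = p ∨ j = p ∨ p ≠ i ∧ p ≠ j := by tauto
  all_goals obtain rfl | rfl | ⟨hqi, hqj⟩ : i = q ∨ j = q ∨ q ≠ i ∧ q ≠ j := by tauto
  all_goals simp only [*, planeRotation_left, planeRotation_right, planeRotation_of_ne, ne_eq,
    not_false_eq_true, dotProduct_add, dotProduct_sub, dotProduct_smul, dotProduct_single,
    Pi.add_apply, Pi.sub_apply, Pi.smul_apply, Pi.single_apply, Matrix.one_apply, Ne.symm,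
    smul_eq_mul, mul_one, mul_zero, add_zero, zero_add, sub_zero, zero_sub, ↓reduceIte]
  · linear_combination hφ
  · ring
  · ring
  · linear_combination hφ
  · simp only [eq_comm]

theorem sum_sq_planeRotation_mul (hij : i ≠ j) (φ : ℝ) (b : n → ℝ) (p : n) :
    ∑ q, planeRotation i j φ p q ^ 2 * b q =
      b p + Real.sin φ ^ 2 * (b j - b i) *
        ((Pi.single i 1 : n → ℝ) p - (Pi.single j 1 : n → ℝ) p) := by
  have hφ := Real.cos_sq_add_sin_sq φ
  have hcross (q : n) : (Pi.single i 1 : n → ℝ) q * (Pi.single j 1 : n → ℝ) q = 0 := by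
    rcases eq_or_ne q i with rfl | hq
    · simp [hij]
    · simp [hq]
  have hsq (p q : n) : (Pi.single p 1 : n → ℝ) q ^ 2 = (Pi.single p 1 : n → ℝ) q := by
    rcases eq_or_ne q p with rfl | hq <;> simp [*]
  obtain rfl | rfl | ⟨hi, hj⟩ : i = p ∨ j = p ∨ p ≠ i ∧ p ≠ j := by tauto
  · have hrow (q : n) : planeRotation i j φ i q ^ 2 =
        Real.cos φ ^ 2 * (Pi.single i 1 : n → ℝ) q +
          Real.sin φ ^ 2 * (Pi.single j 1 : n → ℝ) q := by
      rw [planeRotation_left, Pi.add_apply, Pi.smul_apply, Pi.smul_apply, smul_eq_mul, smul_eq_mul]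
      linear_combination Real.cos φ ^ 2 * hsq i q + Real.sin φ ^ 2 * hsq j q +
        2 * Real.cos φ * Real.sin φ * hcross q
    simp only [hrow, Pi.single_apply, mul_ite, mul_one, mul_zero, add_mul, ite_mul, zero_mul,
      Finset.sum_add_distrib, Finset.sum_ite_eq', Finset.mem_univ, ↓reduceIte, hij, sub_zero]
    linear_combination b i * hφ
  · have hrow (q : n) : planeRotation i j φ j q ^ 2 =
        Real.cos φ ^ 2 * (Pi.single j 1 : n → ℝ) q +
          Real.sin φ ^ 2 * (Pi.single i 1 : n → ℝ) q := by
      rw [planeRotation_right hij, Pi.sub_apply, Pi.smul_apply, Pi.smul_apply, smul_eq_mul,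
        smul_eq_mul]
      linear_combination Real.cos φ ^ 2 * hsq j q + Real.sin φ ^ 2 * hsq i q -
        2 * Real.cos φ * Real.sin φ * hcross q
    simp only [hrow, Pi.single_apply, mul_ite, mul_one, mul_zero, add_mul, ite_mul, zero_mul,
      Finset.sum_add_distrib, Finset.sum_ite_eq', Finset.mem_univ, ↓reduceIte, hij.symm, zero_sub]
    linear_combination b j * hφ
  · simp [planeRotation_of_ne hi hj, hi, hj, Pi.single_apply]

theorem trace_diagonal_mul_planeRotation (hij : i ≠ j) (φ : ℝ) (a b : n → ℝ) :
    (Matrix.diagonal a *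
      (planeRotation i j φ * Matrix.diagonal b * (planeRotation i j φ)ᵀ)).trace =
      ∑ p, a p * b p + Real.sin φ ^ 2 * ((a i - a j) * (b j - b i)) := by
  have hdiag (p) : (planeRotation i j φ * Matrix.diagonal b * (planeRotation i j φ)ᵀ) p p =
      ∑ q, planeRotation i j φ p q ^ 2 * b q := by
    rw [Matrix.mul_apply]
    refine Finset.sum_congr rfl fun q _ => ?_
    rw [Matrix.mul_diagonal, Matrix.transpose_apply]
    ring
  simp only [Matrix.trace, Matrix.diag_apply, Matrix.diagonal_mul, hdiag,
    sum_sq_planeRotation_mul hij, mul_add, mul_sub, Finset.sum_add_distrib, Finset.sum_sub_distrib]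
  simp only [Pi.single_apply, mul_ite, mul_one, mul_zero, Finset.sum_ite_eq', Finset.mem_univ,
    ↓reduceIte]
  ring

end PlaneRotation

section Stationarity

variable {n m : ℕ} {S₀ U : Matrix (Fin n) (Fin n) ℝ} {τ : ℝ} {W : Matrix (Fin n) (Fin m) ℝ}

theorem transportMap_mul_eq_of_isLocalMinOn (h₀ : S₀.PosDef) (hτ : 0 < τ)
    (hmin : IsLocalMinOn (funcLoss S₀ τ) (rankManifold n m W.rank) W) :
    transportMap S₀ (W * Wᵀ + τ • 1) * W = W := by
  have hgrad := hasFDerivAt_mul_eq_zero_of_isLocalMinOn_rankManifold (hasFDerivAt_funcLoss h₀ hτ W)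
    hmin (1 - transportMap S₀ (W * Wᵀ + τ • 1))
  have hT := transpose_transportMap h₀.posSemidef
    (posDef_mul_transpose_add_smul_one hτ W).posSemidef
  set T := transportMap S₀ (W * Wᵀ + τ • 1)
  have hnorm : ‖(1 - T) * W‖ ^ 2 = 0 := by
    rw [frobenius_norm_sq_eq_trace, Matrix.trace_mul_comm, Matrix.transpose_mul,
      Matrix.transpose_sub, Matrix.transpose_one, hT]
    exact (mul_eq_zero.1 hgrad).resolve_left two_ne_zero
  have hzero : (1 - T) * W = 0 := norm_eq_zero.1 (pow_eq_zero_iff two_ne_zero |>.1 hnorm)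
  rwa [Matrix.sub_mul, Matrix.one_mul, sub_eq_zero, eq_comm] at hzero

theorem mul_mul_transpose_eq_of_isLocalMinOn (h₀ : S₀.PosDef) (hτ : 0 < τ)
    (hmin : IsLocalMinOn (funcLoss S₀ τ) (rankManifold n m W.rank) W) :
    S₀ * (W * Wᵀ) = W * Wᵀ * (W * Wᵀ) + τ • (W * Wᵀ) := by
  have hTW := transportMap_mul_eq_of_isLocalMinOn h₀ hτ hmin
  have hS := posDef_mul_transpose_add_smul_one hτ W
  have hpush := transportMap_mul_mul_transportMap h₀ hS
  set T := transportMap S₀ (W * Wᵀ + τ • 1)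
  have hTK : T * (W * Wᵀ) = W * Wᵀ := by rw [← Matrix.mul_assoc, hTW]
  calc S₀ * (W * Wᵀ) = T * (W * Wᵀ + τ • 1) * T * (W * Wᵀ) := by rw [hpush]
    _ = T * (W * Wᵀ + τ • 1) * (W * Wᵀ) := by rw [Matrix.mul_assoc _ T, hTK]
    _ = W * Wᵀ * (W * Wᵀ) + τ • (W * Wᵀ) := by
      rw [Matrix.mul_add, hTK, Matrix.add_mul, Matrix.mul_smul, Matrix.mul_one, Matrix.smul_mul,
        hTK]

theorem posDef_orthogonal_conj (hU : U ∈ Matrix.orthogonalGroup (Fin n) ℝ) (h₀ : S₀.PosDef) :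
    (U * S₀ * Uᵀ).PosDef :=
  h₀.mul_mul_conjTranspose_same (Matrix.vecMul_injective_of_isUnit
    (.of_mul_eq_one_right _ ((Matrix.mem_orthogonalGroup_iff' _ _).1 hU)))

theorem gram_orthogonal_mul_add_smul_one (hU : U ∈ Matrix.orthogonalGroup (Fin n) ℝ) (τ : ℝ)
    (W : Matrix (Fin n) (Fin m) ℝ) :
    U * W * (U * W)ᵀ + τ • 1 = U * (W * Wᵀ + τ • 1) * Uᵀ := by
  rw [Matrix.mul_add, Matrix.add_mul, Matrix.mul_smul, Matrix.mul_one, Matrix.smul_mul,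
    (Matrix.mem_orthogonalGroup_iff _ _).1 hU, Matrix.transpose_mul]
  simp only [Matrix.mul_assoc]

theorem funcLoss_conj (hU : U ∈ Matrix.orthogonalGroup (Fin n) ℝ) (h₀ : S₀.PosSemidef)
    (hτ : 0 < τ) (W : Matrix (Fin n) (Fin m) ℝ) :
    funcLoss (U * S₀ * Uᵀ) τ (U * W) = funcLoss S₀ τ W := by
  rw [funcLoss, funcLoss, covLoss, covLoss, gram_orthogonal_mul_add_smul_one hU,
    buresWassersteinSq_conj hU h₀ (posDef_mul_transpose_add_smul_one hτ W).posSemidef]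

theorem rank_orthogonal_mul (hU : U ∈ Matrix.orthogonalGroup (Fin n) ℝ)
    (W : Matrix (Fin n) (Fin m) ℝ) : (U * W).rank = W.rank :=
  Matrix.rank_mul_eq_right_of_isUnit_det U W
    (Matrix.isUnit_det_of_left_inverse ((Matrix.mem_orthogonalGroup_iff' _ _).1 hU))

theorem isLocalMinOn_funcLoss_conj {k : ℕ} (hU : U ∈ Matrix.orthogonalGroup (Fin n) ℝ)
    (h₀ : S₀.PosSemidef) (hτ : 0 < τ)
    (hmin : IsLocalMinOn (funcLoss (U * S₀ * Uᵀ) τ) (rankManifold n m k) (U * W)) :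
    IsLocalMinOn (funcLoss S₀ τ) (rankManifold n m k) W := by
  have hcont : Continuous fun V : Matrix (Fin n) (Fin m) ℝ => U * V :=
    continuous_const.matrix_mul continuous_id
  have hlim : Filter.Tendsto (fun V => U * V) (𝓝[rankManifold n m k] W)
      (𝓝[rankManifold n m k] (U * W)) :=
    hcont.continuousWithinAt.tendsto_nhdsWithin fun V hV => (rank_orthogonal_mul hU V).trans hV
  filter_upwards [hlim.eventually hmin] with V hV
  simpa only [funcLoss_conj hU h₀ hτ] using hV

end Stationarity

section DiagonalTarget

theorem diagonal_add_smul_one {ι R : Type*} [DecidableEq ι] [Semiring R] (s : ι → R) (τ : R) :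
    Matrix.diagonal s + τ • (1 : Matrix ι ι R) = Matrix.diagonal fun i => s i + τ := by
  rw [Matrix.smul_one_eq_diagonal, Matrix.diagonal_add]

variable {n m : ℕ} {a b lam s : Fin n → ℝ} {τ : ℝ} {W : Matrix (Fin n) (Fin m) ℝ} {i j : Fin n}

theorem exists_mul_transpose_eq_diagonal_of_isLocalMinOn (hlam : Function.Injective lam)
    (hpos : ∀ i, 0 < lam i) (hτ : 0 < τ)
    (hmin : IsLocalMinOn (funcLoss (Matrix.diagonal lam) τ) (rankManifold n m W.rank) W) :
    ∃ s : Fin n → ℝ, W * Wᵀ = Matrix.diagonal s ∧ ∀ i, s i = 0 ∨ s i = lam i - τ := by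
  have hK := mul_mul_transpose_eq_of_isLocalMinOn (.diagonal hpos) hτ hmin
  have hcomm : Commute (Matrix.diagonal lam) (W * Wᵀ) := by
    refine hK.trans ?_
    simpa [Matrix.mul_assoc] using (congrArg Matrix.transpose hK).symm
  obtain ⟨s, hs⟩ := exists_eq_diagonal_of_commute_diagonal hlam hcomm
  refine ⟨s, hs, fun i => ?_⟩
  rw [hs, Matrix.diagonal_mul_diagonal, Matrix.diagonal_mul_diagonal, ← Matrix.diagonal_smul,
    Matrix.diagonal_add, Matrix.diagonal_eq_diagonal_iff] at hK
  have hKi : lam i * s i = s i * s i + τ * s i := hK i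
  have hroot : s i * (s i - (lam i - τ)) = 0 := by
    linear_combination -hKi
  exact (mul_eq_zero.1 hroot).imp_right sub_eq_zero.1

theorem buresWassersteinSq_planeRotation_lt (ha : ∀ p, 0 < a p) (hb : ∀ p, 0 < b p)
    (haij : a j < a i) (hbij : b i < b j) {φ : ℝ} (hφ : Real.sin φ ≠ 0) :
    buresWassersteinSq (planeRotation i j φ * Matrix.diagonal b * (planeRotation i j φ)ᵀ)
      (Matrix.diagonal a) < buresWassersteinSq (Matrix.diagonal b) (Matrix.diagonal a) := by
  have hij : i ≠ j := fun h => haij.ne (h ▸ rfl)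
  have hR := planeRotation_mem_orthogonalGroup hij φ
  have hRR := (Matrix.mem_orthogonalGroup_iff' _ _).1 hR
  have hDb : (Matrix.diagonal b).PosDef := .diagonal hb
  have hle := trace_matSqrt_mul_matSqrt_le_fidelity (.diagonal ha) (posDef_orthogonal_conj hR hDb)
  rw [matSqrt_conj hR hDb.posSemidef, matSqrt_diagonal fun p => (ha p).le,
    matSqrt_diagonal fun p => (hb p).le, trace_diagonal_mul_planeRotation hij] at hle
  have hgain : 0 < Real.sin φ ^ 2 * ((√(a i) - √(a j)) * (√(b j) - √(b i))) :=
    mul_pos (by positivity) (mul_pos (sub_pos.2 (Real.sqrt_lt_sqrt (ha j).le haij))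
      (sub_pos.2 (Real.sqrt_lt_sqrt (hb i).le hbij)))
  rw [buresWassersteinSq_eq, buresWassersteinSq_eq,
    fidelity_diagonal (fun p => (ha p).le) (fun p => (hb p).le), Matrix.trace_mul_comm,
    ← Matrix.mul_assoc, hRR, Matrix.one_mul]
  linarith

/-- If a direction with a smaller target eigenvalue carried more variance, a small rotation towards
the direction with the larger one would decrease the loss. -/
theorem le_of_isLocalMinOn_of_lt (hpos : ∀ i, 0 < lam i) (hτ : 0 < τ)
    (hmin : IsLocalMinOn (funcLoss (Matrix.diagonal lam) τ) (rankManifold n m W.rank) W)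
    (hW : W * Wᵀ = Matrix.diagonal s) (hlt : lam j < lam i) : s j ≤ s i := by
  by_contra! hs
  have hij : i ≠ j := fun h => hlt.ne (h ▸ rfl)
  have hs_nonneg : ∀ p, 0 ≤ s p :=
    Matrix.posSemidef_diagonal_iff.1 (hW ▸ posSemidef_mul_transpose_self W)
  have hlim : Filter.Tendsto (fun φ => planeRotation i j φ * W) (𝓝[>] 0)
      (𝓝[rankManifold n m W.rank] W) := by
    have hcont : Continuous fun φ => planeRotation i j φ * W :=
      (continuous_planeRotation i j).matrix_mul continuous_const
    refine tendsto_nhdsWithin_iff.2 ⟨?_, .of_forall fun φ =>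
      rank_orthogonal_mul (planeRotation_mem_orthogonalGroup hij φ) W⟩
    simpa only [planeRotation_zero hij, Matrix.one_mul] using
      (hcont.tendsto 0).mono_left nhdsWithin_le_nhds
  obtain ⟨φ, hφmin, hφ⟩ :=
    ((hlim.eventually hmin).and (Ioo_mem_nhdsGT Real.pi_pos)).exists
  refine hφmin.not_gt ?_
  rw [funcLoss, funcLoss, covLoss, covLoss,
    gram_orthogonal_mul_add_smul_one (planeRotation_mem_orthogonalGroup hij φ), hW,
    diagonal_add_smul_one]
  exact buresWassersteinSq_planeRotation_lt hpos
    (fun p => add_pos_of_nonneg_of_pos (hs_nonneg p) hτ) hlt (add_lt_add_left hs τ)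
    (Real.sin_pos_of_mem_Ioo hφ).ne'

theorem mem_iff_lt_card_of_isLowerSet {J : Finset (Fin n)} (hJ : IsLowerSet (J : Set (Fin n)))
    (i : Fin n) : i ∈ J ↔ (i : ℕ) < J.card := by
  refine ⟨fun hi => ?_, fun hi => by_contra fun hiJ => hi.not_ge ?_⟩
  · have hsub : Finset.Iic i ⊆ J := fun p hp => hJ (Finset.mem_Iic.1 hp) hi
    simpa only [Fin.card_Iic, Nat.succ_le_iff] using Finset.card_le_card hsub
  · have hsub : J ⊆ Finset.Iio i := fun p hp =>
      Finset.mem_Iio.2 (lt_of_not_ge fun hip => hiJ (hJ hip hp))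
    simpa only [Fin.card_Iio] using Finset.card_le_card hsub

theorem mul_transpose_add_smul_one_eq_of_isLocalMinOn (hlam : StrictAnti lam)
    (hpos : ∀ i, 0 < lam i) (hτ : 0 < τ)
    (hmin : IsLocalMinOn (funcLoss (Matrix.diagonal lam) τ) (rankManifold n m W.rank) W) :
    W * Wᵀ + τ • (1 : Matrix (Fin n) (Fin n) ℝ) =
      Matrix.diagonal fun i : Fin n => if (i : ℕ) < W.rank then lam i else τ := by
  obtain ⟨s, hW, hs⟩ :=
    exists_mul_transpose_eq_diagonal_of_isLocalMinOn hlam.injective hpos hτ hmin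
  have hs_nonneg : ∀ p, 0 ≤ s p :=
    Matrix.posSemidef_diagonal_iff.1 (hW ▸ posSemidef_mul_transpose_self W)
  let J := Finset.univ.filter fun i => s i ≠ 0
  have hJ : IsLowerSet (J : Set (Fin n)) := fun j i hij hj => by
    rcases hij.eq_or_lt with rfl | hlt
    · exact hj
    · have hj : s j ≠ 0 := (Finset.mem_filter.1 hj).2
      exact Finset.mem_filter.2 ⟨Finset.mem_univ i, (((hs_nonneg j).lt_of_ne' hj).trans_le
        (le_of_isLocalMinOn_of_lt hpos hτ hmin hW (hlam hlt))).ne'⟩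
  have hcard : J.card = W.rank := by
    rw [← Matrix.rank_self_mul_transpose, hW, Matrix.rank_diagonal, Fintype.card_subtype]
  rw [hW, diagonal_add_smul_one]
  refine congrArg Matrix.diagonal (funext fun i => ?_)
  have hi : s i ≠ 0 ↔ (i : ℕ) < W.rank := by
    simpa [J, hcard] using mem_iff_lt_card_of_isLowerSet hJ i
  split_ifs with hik
  · rw [(hs i).resolve_left (hi.2 hik), sub_add_cancel]
  · rw [not_not.1 (mt hi.1 hik), zero_add]

theorem funcLoss_eq_of_isLocalMinOn (hlam : StrictAnti lam) (hpos : ∀ i, 0 < lam i) (hτ : 0 < τ)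
    (hmin : IsLocalMinOn (funcLoss (Matrix.diagonal lam) τ) (rankManifold n m W.rank) W) :
    funcLoss (Matrix.diagonal lam) τ W =
      ∑ i : Fin n, if (i : ℕ) < W.rank then 0 else (√(lam i) - √τ) ^ 2 := by
  rw [funcLoss, covLoss, mul_transpose_add_smul_one_eq_of_isLocalMinOn hlam hpos hτ hmin,
    buresWassersteinSq_diagonal fun i => (hpos i).le]
  · refine Finset.sum_congr rfl fun i _ => ?_
    split_ifs
    · rw [sub_self, zero_pow two_ne_zero]
    · rfl
  · intro i
    split_ifs
    · exact (hpos i).le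
    · exact hτ.le

end DiagonalTarget

section GlobalMinimizers

variable {n m : ℕ} {S₀ Om : Matrix (Fin n) (Fin n) ℝ} {lam : Fin n → ℝ} {τ : ℝ}

theorem half_norm_sq_sub_trace_le_funcLoss (h₀ : S₀.PosDef) (hτ : 0 < τ)
    (W : Matrix (Fin n) (Fin m) ℝ) : 1 / 2 * ‖W‖ ^ 2 - S₀.trace ≤ funcLoss S₀ τ W := by
  have hle := half_trace_sub_trace_le_buresWassersteinSq h₀
    (posDef_mul_transpose_add_smul_one hτ W).posSemidef
  have htrace : 0 ≤ (τ • (1 : Matrix (Fin n) (Fin n) ℝ)).trace :=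
    (Matrix.PosSemidef.one.smul hτ.le).trace_nonneg
  rw [Matrix.trace_add, ← frobenius_norm_sq_eq_trace] at hle
  rw [funcLoss, covLoss]
  linarith

theorem exists_isMinOn_funcLoss_rank_le (h₀ : S₀.PosDef) (hτ : 0 < τ) (m k : ℕ) :
    ∃ W ∈ {W : Matrix (Fin n) (Fin m) ℝ | W.rank ≤ k},
      IsMinOn (funcLoss S₀ τ) {W | W.rank ≤ k} W := by
  have : ProperSpace (Matrix (Fin n) (Fin m) ℝ) :=
    FiniteDimensional.proper ℝ (Matrix (Fin n) (Fin m) ℝ)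
  have hcont : Continuous (funcLoss (m := m) S₀ τ) :=
    continuous_iff_continuousAt.2 fun W => (hasFDerivAt_funcLoss h₀ hτ W).continuousAt
  have hcoercive : Filter.Tendsto (funcLoss (m := m) S₀ τ)
      (Filter.cocompact (Matrix (Fin n) (Fin m) ℝ)) Filter.atTop := by
    refine Filter.tendsto_atTop_mono (half_norm_sq_sub_trace_le_funcLoss h₀ hτ)
      (Filter.tendsto_atTop_add_const_right _ _ (.const_mul_atTop (by norm_num)
        ((Filter.tendsto_pow_atTop two_ne_zero).comp (tendsto_norm_cocompact_atTop))))
  have h0 : (0 : Matrix (Fin n) (Fin m) ℝ).rank ≤ k := by simp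
  exact hcont.continuousOn.exists_isMinOn' (isClosed_rank_le k) h0
    ((hcoercive.eventually_ge_atTop _).filter_mono inf_le_left)

theorem funcLoss_le_of_isLocalMinOn_of_rank_le (hlam : StrictAnti lam) (hpos : ∀ i, 0 < lam i)
    (hτ : 0 < τ) {W W' : Matrix (Fin n) (Fin m) ℝ}
    (hmin : IsLocalMinOn (funcLoss (Matrix.diagonal lam) τ) (rankManifold n m W.rank) W)
    (hrank : W'.rank ≤ W.rank) :
    funcLoss (Matrix.diagonal lam) τ W ≤ funcLoss (Matrix.diagonal lam) τ W' := by
  obtain ⟨V, hV, hVmin⟩ :=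
    exists_isMinOn_funcLoss_rank_le (.diagonal hpos : (Matrix.diagonal lam).PosDef) hτ m W.rank
  have hVlocal : IsLocalMinOn (funcLoss (Matrix.diagonal lam) τ) (rankManifold n m V.rank) V :=
    (hVmin.on_subset fun U hU => (le_of_eq hU).trans hV).localize
  refine le_trans ?_ (hVmin hrank)
  rw [funcLoss_eq_of_isLocalMinOn hlam hpos hτ hmin,
    funcLoss_eq_of_isLocalMinOn hlam hpos hτ hVlocal]
  refine Finset.sum_le_sum fun i _ => ?_
  have hV' : V.rank ≤ W.rank := hV
  split_ifs with hiW hiV hiV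
  · exact le_rfl
  · positivity
  · omega
  · exact le_rfl

theorem exists_isLocalMinOn_diagonal (hOm : Om ∈ Matrix.orthogonalGroup (Fin n) ℝ)
    (hpos : ∀ i, 0 < lam i) (hτ : 0 < τ) {W : Matrix (Fin n) (Fin m) ℝ}
    (hmin : IsLocalMinOn (funcLoss (Om * Matrix.diagonal lam * Omᵀ) τ)
      (rankManifold n m W.rank) W) :
    ∃ V : Matrix (Fin n) (Fin m) ℝ, W = Om * V ∧
      IsLocalMinOn (funcLoss (Matrix.diagonal lam) τ) (rankManifold n m V.rank) V := by
  have hW : W = Om * (Omᵀ * W) := by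
    rw [← Matrix.mul_assoc, (Matrix.mem_orthogonalGroup_iff _ _).1 hOm, Matrix.one_mul]
  have hrank : (Omᵀ * W).rank = W.rank := by rw [← rank_orthogonal_mul hOm, ← hW]
  refine ⟨Omᵀ * W, hW, ?_⟩
  rw [hrank]
  refine isLocalMinOn_funcLoss_conj hOm (Matrix.PosDef.diagonal hpos).posSemidef hτ ?_
  rwa [← hW]

theorem isMinOn_of_isLocalMinOn (hOm : Om ∈ Matrix.orthogonalGroup (Fin n) ℝ)
    (hlam : StrictAnti lam) (hpos : ∀ i, 0 < lam i) (hτ : 0 < τ) {W : Matrix (Fin n) (Fin m) ℝ}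
    (hmin : IsLocalMinOn (funcLoss (Om * Matrix.diagonal lam * Omᵀ) τ)
      (rankManifold n m W.rank) W) :
    IsMinOn (funcLoss (Om * Matrix.diagonal lam * Omᵀ) τ) {W' | W'.rank ≤ W.rank} W := by
  obtain ⟨V, rfl, hV⟩ := exists_isLocalMinOn_diagonal hOm hpos hτ hmin
  intro W' hW'
  obtain ⟨V', rfl⟩ : ∃ V' : Matrix (Fin n) (Fin m) ℝ, W' = Om * V' :=
    ⟨Omᵀ * W', by
      rw [← Matrix.mul_assoc, (Matrix.mem_orthogonalGroup_iff _ _).1 hOm, Matrix.one_mul]⟩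
  have h₀ : (Matrix.diagonal lam).PosSemidef := (Matrix.PosDef.diagonal hpos).posSemidef
  simp only [Set.mem_ofPred_eq, rank_orthogonal_mul hOm] at hW'
  simpa only [Set.mem_ofPred_eq, funcLoss_conj hOm h₀ hτ] using
    funcLoss_le_of_isLocalMinOn_of_rank_le hlam hpos hτ hV hW'

theorem mul_transpose_add_smul_one_eq_conj_of_isLocalMinOn
    (hOm : Om ∈ Matrix.orthogonalGroup (Fin n) ℝ) (hlam : StrictAnti lam) (hpos : ∀ i, 0 < lam i)
    (hτ : 0 < τ) {W : Matrix (Fin n) (Fin m) ℝ}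
    (hmin : IsLocalMinOn (funcLoss (Om * Matrix.diagonal lam * Omᵀ) τ)
      (rankManifold n m W.rank) W) :
    W * Wᵀ + τ • (1 : Matrix (Fin n) (Fin n) ℝ) =
      Om * Matrix.diagonal (fun i : Fin n => if (i : ℕ) < W.rank then lam i else τ) * Omᵀ := by
  obtain ⟨V, rfl, hV⟩ := exists_isLocalMinOn_diagonal hOm hpos hτ hmin
  rw [gram_orthogonal_mul_add_smul_one hOm, rank_orthogonal_mul hOm,
    mul_transpose_add_smul_one_eq_of_isLocalMinOn hlam hpos hτ hV]

end GlobalMinimizers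

theorem mainTheorem5_general (N : ℕ) (hN : 1 ≤ N) (d : ℕ → ℕ)
    (S₀ Om : Matrix (Fin (d N)) (Fin (d N)) ℝ) (lam : Fin (d N) → ℝ)
    (hOm : Om ∈ Matrix.orthogonalGroup (Fin (d N)) ℝ)
    (hS₀ : S₀ = Om * Matrix.diagonal lam * Omᵀ)
    (hlam : StrictAnti lam) (hpos : ∀ i, 0 < lam i)
    (τ : ℝ) (hτ : 0 < τ) :
    (∀ θ : Params d N, IsCriticalPoint (paramLoss d N S₀ τ) θ →
      IsCriticalPointOn (funcLoss S₀ τ)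
        (rankManifold (d N) (d 0) (endToEnd d N θ).rank) (endToEnd d N θ)) ∧
    (∀ θ : Params d N, (endToEnd d N θ).rank = minWidth d N →
      (IsLocalMin (paramLoss d N S₀ τ) θ ↔
        IsLocalMinOn (funcLoss S₀ τ) (rankManifold (d N) (d 0) (minWidth d N))
          (endToEnd d N θ)) ∧
      (IsLocalMinOn (funcLoss S₀ τ) (rankManifold (d N) (d 0) (minWidth d N))
          (endToEnd d N θ) ↔
        IsMinOn (funcLoss S₀ τ) (rankManifold (d N) (d 0) (minWidth d N))
          (endToEnd d N θ)) ∧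
      (IsLocalMin (paramLoss d N S₀ τ) θ →
        endToEnd d N θ * (endToEnd d N θ)ᵀ + τ • (1 : Matrix (Fin (d N)) (Fin (d N)) ℝ) =
          Om * Matrix.diagonal (fun i : Fin (d N) => if (i : ℕ) < minWidth d N then lam i else τ)
            * Omᵀ)) := by
  obtain ⟨N, rfl⟩ := Nat.exists_eq_succ_of_ne_zero (Nat.one_le_iff_ne_zero.1 hN)
  subst hS₀
  have h₀ := posDef_orthogonal_conj hOm (Matrix.PosDef.diagonal hpos)
  refine ⟨fun θ hθ => isCriticalPointOn_of_isCriticalPoint h₀ hτ hθ, fun θ hrank => ?_⟩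
  rw [← hrank]
  refine ⟨⟨isLocalMinOn_funcLoss_of_isLocalMin_paramLoss, fun h => ?_⟩,
    ⟨fun h => ?_, IsMinOn.localize⟩, fun h => ?_⟩
  · exact isLocalMin_paramLoss_of_isLocalMinOn_funcLoss hrank (hrank ▸ h)
  · exact (isMinOn_of_isLocalMinOn hOm hlam hpos hτ h).on_subset fun _ => le_of_eq
  · exact mul_transpose_add_smul_one_eq_conj_of_isLocalMinOn hOm hlam hpos hτ
      (isLocalMinOn_funcLoss_of_isLocalMin_paramLoss h)

theorem mainTheorem5 (N : ℕ) (hN : 1 ≤ N) (d : ℕ → ℕ)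
    (S₀ Om : Matrix (Fin (d N)) (Fin (d N)) ℝ) (lam : Fin (d N) → ℝ)
    (hOm : Om ∈ Matrix.orthogonalGroup (Fin (d N)) ℝ)
    (hS₀ : S₀ = Om * Matrix.diagonal lam * Omᵀ)
    (hlam : StrictAnti lam) (hpos : ∀ i, 0 < lam i)
    (τ : ℝ) (hτ : 0 < τ) (hτ_le : ∀ i, τ ≤ lam i) :
    (∀ θ : Params d N, IsCriticalPoint (paramLoss d N S₀ τ) θ →
      IsCriticalPointOn (funcLoss S₀ τ)
        (rankManifold (d N) (d 0) (endToEnd d N θ).rank) (endToEnd d N θ)) ∧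
    (∀ θ : Params d N, (endToEnd d N θ).rank = minWidth d N →
      (IsLocalMin (paramLoss d N S₀ τ) θ ↔
        IsLocalMinOn (funcLoss S₀ τ) (rankManifold (d N) (d 0) (minWidth d N))
          (endToEnd d N θ)) ∧
      (IsLocalMinOn (funcLoss S₀ τ) (rankManifold (d N) (d 0) (minWidth d N))
          (endToEnd d N θ) ↔
        IsMinOn (funcLoss S₀ τ) (rankManifold (d N) (d 0) (minWidth d N))
          (endToEnd d N θ)) ∧
      (IsLocalMin (paramLoss d N S₀ τ) θ →
        endToEnd d N θ * (endToEnd d N θ)ᵀ + τ • (1 : Matrix (Fin (d N)) (Fin (d N)) ℝ) =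
          Om * Matrix.diagonal (fun i : Fin (d N) => if (i : ℕ) < minWidth d N then lam i else τ)
            * Omᵀ)) :=
  mainTheorem5_general N hN d S₀ Om lam hOm hS₀ hlam hpos τ hτ
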